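/- Let $X$ be a smooth, projective, geometrically irreducible curve over the finite field $\mathbb{F}_q$, with function field $K$, and let $\infty\in X(\mathbb{F}_q)$ be a rational point. Let $A=\mathcal{O}_X(X\setminus\{\infty\})$ be the ring of functions regular away from $\infty$, let $\deg a$ be the opposite of the normalized valuation at $\infty$ of $a\in A\setminus\{0\}$, let $K_\infty$ be the completion of $K$ with respect to the absolute value with $\|a\|=q^{\deg a}$, and let $\mathbb{C}_\infty$ be the completion of an algebraic closure of $K_\infty$. Let $\tau\colon x\mapsto x^q$ on $\mathbb{C}_\infty$, and let $\phi\colon A\to\mathbb{C}_\infty[\tau]\subseteq\mathrm{End}_{\mathbb{F}_q}(\mathbb{C}_\infty)$ be a Drinfeld module of rank $1$ (for instance a Drinfeld–Hayes module, i.e. a normalized one): a ring homomorphism such that for every $a\neq 0$ the operator $\phi_a$ has degree $\deg a$ in $\tau$ and constant term $a$. Let $\mathbb{C}_\infty\hat\otimes A$ be the completion of the ring $\mathbb{C}_\infty\otimes_{\mathbb{F}_q}A$ for the sup norm $\|\sum_i c_i\otimes a_i\|=\sup_i\|c_i\|$ (where $(a_i)_i$ is any $\mathbb{F}_q$-basis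 of $A$; the norm does not depend on it), and let $$Sf_\phi(A)=\{\omega\in\mathbb{C}_\infty\hat\otimes A \;:\; \phi_a(\omega)=(1\otimes a)\,\omega\ \text{ for all } a\in A\}$$ be the $A$-module of special functions of $\phi$, where $\phi_a$ acts by $\sum_i c_i\otimes a_i\mapsto\sum_i\phi_a(c_i)\otimes a_i$ and $a\in A$ acts as multiplication by $1\otimes a$. Suppose that $Sf_\phi(A)\cong A$ as $A$-modules. Then there is an $\omega\in Sf_\phi(A)$ that is invertible in the ring $\mathbb{C}_\infty\hat\otimes A$. Moreover $\omega$ can be chosen such that, for every $\mathbb{F}_q$-basis $(a_i)_{i\ge 0}$ of $A$ with strictly increasing degrees, the coefficients $c_i\in\mathbb{C}_\infty$ in $\omega=\sum_i c_i\otimes a_i$ have strictly decreasing norms $\|c_i\|$. -/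

import Mathlib

open scoped TensorProduct WithZero NNReal

noncomputable section

namespace SpecialFunctions

/-! ### The completed tensor product `C ⊗̂ M` -/

/-- The completion of an ultrametric normed group is ultrametric. -/
theorem isUltrametricDist_completion (E : Type*) [SeminormedAddCommGroup E]
    [IsUltrametricDist E] : IsUltrametricDist (UniformSpace.Completion E) := by
  refine IsUltrametricDist.isUltrametricDist_of_forall_norm_add_le_max_norm fun x y => ?_
  induction x, y using UniformSpace.Completion.induction_on₂ with
  | hp => exact isClosed_le (by fun_prop) (by fun_prop)
  | ih a b =>
    rw [← UniformSpace.Completion.coe_add]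
    simpa using IsUltrametricDist.norm_add_le_max a b

section Tensor

variable (F C A : Type*) [Field F] [Finite F] [NormedField C] [IsUltrametricDist C]
  [Algebra F C] [CommRing A] [Algebra F A]

/-- `C ⊗ A` over `F`, as a type of its own, in order to carry the sup norm. -/
def Tensor : Type _ := C ⊗[F] A

instance : CommRing (Tensor F C A) := inferInstanceAs (CommRing (C ⊗[F] A))

instance : Algebra F (Tensor F C A) := inferInstanceAs (Algebra F (C ⊗[F] A))

variable {F C A}

/-- The pure tensor `c ⊗ a`. -/
def tmul (F : Type*) {C A : Type*} [Field F] [NormedField C] [Algebra F C] [CommRing A]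
    [Algebra F A] (c : C) (a : A) : Tensor F C A := (c ⊗ₜ[F] a : C ⊗[F] A)

theorem tensor_induction {motive : Tensor F C A → Prop} (x : Tensor F C A) (zero : motive 0)
    (tmul : ∀ c a, motive (tmul F c a)) (add : ∀ x y, motive x → motive y → motive (x + y)) :
    motive x :=
  TensorProduct.induction_on (motive := motive) x zero tmul add

/-- The contraction `C ⊗ A → C`, `c ⊗ a ↦ χ(a) c`, by a linear form `χ` on `A`. For the `i`-th
coordinate form of a basis `(aᵢ)` of `A` it maps `∑ cᵢ ⊗ aᵢ` to `cᵢ`. -/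
def contract (χ : Module.Dual F A) : Tensor F C A →ₗ[F] C :=
  (TensorProduct.rid F C).toLinearMap ∘ₗ LinearMap.lTensor C χ

/-- The sup norm on `C ⊗ A`: the supremum of the norms of all contractions. It is the supremum of
the norms of the coordinates with respect to any basis of `A`, see `norm_eq_iSup_coord`. -/
instance : Norm (Tensor F C A) := ⟨fun x => ⨆ χ : Module.Dual F A, ‖contract χ x‖⟩

theorem norm_def (x : Tensor F C A) : ‖x‖ = ⨆ χ : Module.Dual F A, ‖contract χ x‖ := rfl

theorem contract_tmul (χ : Module.Dual F A) (c : C) (a : A) :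
    contract χ (tmul F c a) = χ a • c :=
  (congrArg (TensorProduct.rid F C) (LinearMap.lTensor_tmul C χ c a)).trans
    (TensorProduct.rid_tmul c (χ a))

theorem norm_algebraMap_le_one (r : F) : ‖algebraMap F C r‖ ≤ 1 := by
  rcases eq_or_ne r 0 with rfl | hr
  · simp
  · have : IsOfFinOrder (Units.mk0 r hr) := isOfFinOrder_of_finite _
    obtain ⟨n, hn, h⟩ := isOfFinOrder_iff_pow_eq_one.mp this
    have h' : r ^ n = 1 := by simpa using congrArg Units.val h
    have h2 : ‖algebraMap F C r‖ ^ n = 1 := by rw [← norm_pow, ← map_pow, h']; simp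
    exact ((pow_eq_one_iff_of_nonneg (norm_nonneg _) hn.ne').mp h2).le

theorem norm_smul_le' (r : F) (c : C) : ‖r • c‖ ≤ ‖c‖ := by
  rw [Algebra.smul_def, norm_mul]
  exact mul_le_of_le_one_left (norm_nonneg _) (norm_algebraMap_le_one r)

theorem bddAbove_contract (x : Tensor F C A) :
    BddAbove (Set.range fun χ : Module.Dual F A => ‖contract χ x‖) := by
  suffices h : ∃ B, ∀ χ : Module.Dual F A, ‖contract χ x‖ ≤ B by
    obtain ⟨B, hB⟩ := h
    exact ⟨B, by rintro _ ⟨χ, rfl⟩; exact hB χ⟩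
  induction x using tensor_induction with
  | zero => exact ⟨0, fun χ => by rw [map_zero, norm_zero]⟩
  | tmul c a => exact ⟨‖c‖, fun χ => by rw [contract_tmul]; exact norm_smul_le' _ _⟩
  | add x y hx hy =>
    obtain ⟨B, hB⟩ := hx
    obtain ⟨B', hB'⟩ := hy
    refine ⟨B + B', fun χ => ?_⟩
    rw [map_add]
    exact (norm_add_le _ _).trans (add_le_add (hB χ) (hB' χ))

theorem norm_contract_le (χ : Module.Dual F A) (x : Tensor F C A) : ‖contract χ x‖ ≤ ‖x‖ :=
  le_ciSup (bddAbove_contract x) χ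

theorem tensor_norm_nonneg (x : Tensor F C A) : 0 ≤ ‖x‖ :=
  (norm_nonneg _).trans (norm_contract_le 0 x)

theorem tensor_norm_le {x : Tensor F C A} {B : ℝ}
    (h : ∀ χ : Module.Dual F A, ‖contract χ x‖ ≤ B) : ‖x‖ ≤ B := ciSup_le h

theorem tensor_norm_add_le_max (x y : Tensor F C A) : ‖x + y‖ ≤ max ‖x‖ ‖y‖ := by
  refine tensor_norm_le fun χ => ?_
  rw [map_add]
  exact (IsUltrametricDist.norm_add_le_max _ _).trans
    (max_le_max (norm_contract_le χ x) (norm_contract_le χ y))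

theorem tensor_norm_tmul_le (c : C) (a : A) : ‖tmul F c a‖ ≤ ‖c‖ :=
  tensor_norm_le fun χ => by rw [contract_tmul]; exact norm_smul_le' _ _

theorem tensor_norm_sum_le {ι : Type*} (s : Finset ι) (f : ι → Tensor F C A) {B : ℝ}
    (hB : 0 ≤ B) (h : ∀ i ∈ s, ‖f i‖ ≤ B) : ‖∑ i ∈ s, f i‖ ≤ B := by
  induction s using Finset.cons_induction with
  | empty =>
    refine tensor_norm_le fun χ => ?_
    rw [Finset.sum_empty, map_zero, norm_zero]; exact hB
  | cons i s hi ih =>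
    rw [Finset.sum_cons]
    exact (tensor_norm_add_le_max _ _).trans (max_le (h i (Finset.mem_cons_self i s))
      (ih fun j hj => h j (Finset.mem_cons_of_mem hj)))

/-- Expansion of an element of `C ⊗ A` along a basis of `A`. -/
theorem exists_expansion {ι : Type*} (b : Module.Basis ι F A) (x : Tensor F C A) :
    ∃ s : Finset ι, x = ∑ i ∈ s, tmul F (contract (b.coord i) x) (b i) := by
  classical
  obtain ⟨m, hm⟩ := (TensorProduct.equivFinsuppOfBasisRight b).symm.surjective x
  have hx : x = ∑ i ∈ m.support, tmul F (m i) (b i) :=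
    hm.symm.trans (TensorProduct.equivFinsuppOfBasisRight_symm_apply b m)
  refine ⟨m.support, ?_⟩
  have key : ∀ i ∈ m.support, contract (b.coord i) x = m i := by
    intro i hi
    rw [hx, map_sum, Finset.sum_eq_single i]
    · rw [contract_tmul]; simp
    · intro j _ hj
      rw [contract_tmul]; simp [Finsupp.single_eq_of_ne' hj]
    · intro h; exact absurd hi h
  nth_rw 1 [hx]
  exact Finset.sum_congr rfl fun i hi => by rw [key i hi]

theorem norm_eq_iSup_coord {ι : Type*} (b : Module.Basis ι F A) (x : Tensor F C A) :
    ‖x‖ = ⨆ i, ‖contract (b.coord i) x‖ := by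
  have hb : BddAbove (Set.range fun i => ‖contract (b.coord i) x‖) :=
    (bddAbove_contract x).mono (by rintro _ ⟨i, rfl⟩; exact ⟨b.coord i, rfl⟩)
  refine le_antisymm ?_ (Real.iSup_le (fun i => norm_contract_le _ x) (tensor_norm_nonneg x))
  obtain ⟨s, hs⟩ := exists_expansion b x
  nth_rw 1 [hs]
  exact tensor_norm_sum_le s _ (Real.iSup_nonneg fun i => norm_nonneg _) fun i _ =>
    (tensor_norm_tmul_le _ _).trans (le_ciSup hb i)

theorem tensor_norm_mul_le (x y : Tensor F C A) : ‖x * y‖ ≤ ‖x‖ * ‖y‖ := by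
  let b := Module.Free.chooseBasis F A
  obtain ⟨s, hs⟩ := exists_expansion b x
  obtain ⟨t, ht⟩ := exists_expansion b y
  have h0 : 0 ≤ ‖x‖ * ‖y‖ := mul_nonneg (tensor_norm_nonneg x) (tensor_norm_nonneg y)
  have h : x * y = ∑ i ∈ s, ∑ j ∈ t,
      tmul F (contract (b.coord i) x * contract (b.coord j) y) (b i * b j) := by
    conv_lhs => rw [hs, ht, Finset.sum_mul_sum]
    refine Finset.sum_congr rfl fun i _ => Finset.sum_congr rfl fun j _ => ?_
    exact Algebra.TensorProduct.tmul_mul_tmul _ _ _ _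
  rw [h]
  refine tensor_norm_sum_le _ _ h0 fun i _ => tensor_norm_sum_le _ _ h0 fun j _ => ?_
  refine (tensor_norm_tmul_le _ _).trans ?_
  rw [norm_mul]
  exact mul_le_mul (norm_contract_le _ _) (norm_contract_le _ _) (norm_nonneg _)
    (tensor_norm_nonneg x)

theorem eq_zero_of_tensor_norm (x : Tensor F C A) (h : ‖x‖ = 0) : x = 0 := by
  let b := Module.Free.chooseBasis F A
  obtain ⟨s, hs⟩ := exists_expansion b x
  rw [hs]
  refine Finset.sum_eq_zero fun i _ => ?_
  have : contract (b.coord i) x = 0 :=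
    norm_le_zero_iff.mp ((norm_contract_le _ x).trans h.le)
  rw [this]
  exact TensorProduct.zero_tmul _ _

variable (F C A) in
/-- The sup norm as a ring norm. -/
def tensorRingNorm : RingNorm (Tensor F C A) where
  toFun x := ‖x‖
  map_zero' := le_antisymm (tensor_norm_le fun χ => by simp) (tensor_norm_nonneg _)
  add_le' x y := (tensor_norm_add_le_max x y).trans
    (max_le_add_of_nonneg (tensor_norm_nonneg x) (tensor_norm_nonneg y))
  neg' x := by simp only [norm_def, map_neg, norm_neg]
  mul_le' := tensor_norm_mul_le
  eq_zero_of_map_eq_zero' := eq_zero_of_tensor_norm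

instance : NormedCommRing (Tensor F C A) :=
  { (tensorRingNorm F C A).toNormedRing with mul_comm := mul_comm }

variable (F C A) in
/-- The ring `C ⊗̂ A`, the completion of `C ⊗ A` for the sup norm. -/
def CompletedTensor : Type _ := UniformSpace.Completion (Tensor F C A)

instance : NormedCommRing (CompletedTensor F C A) :=
  inferInstanceAs (NormedCommRing (UniformSpace.Completion (Tensor F C A)))

instance : CompleteSpace (CompletedTensor F C A) :=
  inferInstanceAs (CompleteSpace (UniformSpace.Completion (Tensor F C A)))

variable (F C A) in
/-- The inclusion `C ⊗ A → C ⊗̂ A`. -/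
def toCompleted : Tensor F C A →+* CompletedTensor F C A :=
  (UniformSpace.Completion.coeRingHom : Tensor F C A →+* UniformSpace.Completion (Tensor F C A))

/-- `A` acts on `C ⊗̂ A` through the right factor, `a` acting as multiplication by `1 ⊗ a`. -/
instance : Algebra A (CompletedTensor F C A) :=
  ((toCompleted F C A).comp
    (Algebra.TensorProduct.includeRight : A →ₐ[F] C ⊗[F] A).toRingHom).toAlgebra

/-- `f ⊗ id` on `C ⊗ A`, for an `F`-linear map `f : C → C`. -/
def mapLeft (f : Module.End F C) : Tensor F C A →ₗ[F] Tensor F C A :=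
  LinearMap.rTensor A f

theorem contract_mapLeft (f : Module.End F C) (χ : Module.Dual F A) (x : Tensor F C A) :
    contract χ (mapLeft f x) = f (contract χ x) := by
  induction x using tensor_induction with
  | zero => rw [map_zero, map_zero, map_zero]
  | tmul c a =>
    rw [contract_tmul, map_smul]
    exact contract_tmul χ (f c) a
  | add x y hx hy => rw [map_add, map_add, map_add, hx, hy, map_add]

theorem uniformContinuous_mapLeft (f : Module.End F C) (hf : Continuous f) :
    UniformContinuous (mapLeft f : Tensor F C A → Tensor F C A) := by
  refine uniformContinuous_of_continuousAt_zero (mapLeft f : Tensor F C A →ₗ[F] Tensor F C A) ?_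
  rw [Metric.continuousAt_iff]
  intro ε hε
  obtain ⟨δ, hδ, h⟩ := Metric.continuousAt_iff.mp (hf.continuousAt (x := 0)) (ε / 2) (half_pos hε)
  refine ⟨δ, hδ, fun {x} hx => ?_⟩
  rw [map_zero, dist_zero_right] at *
  refine lt_of_le_of_lt (tensor_norm_le fun χ => ?_) (half_lt_self hε)
  rw [contract_mapLeft]
  have := h (x := contract χ x) (by
    rw [dist_zero_right]; exact (norm_contract_le χ x).trans_lt hx)
  rw [dist_zero_right] at this
  exact this.le

/-- The extension of `f ⊗ id` to `C ⊗̂ A`, for a continuous `F`-linear map `f : C → C`; it maps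
`∑ cᵢ ⊗ aᵢ` to `∑ f(cᵢ) ⊗ aᵢ`. -/
def completedMapLeft (f : Module.End F C) (hf : Continuous f) :
    CompletedTensor F C A →+ CompletedTensor F C A :=
  AddMonoidHom.completion (mapLeft f : Tensor F C A →ₗ[F] Tensor F C A).toAddMonoidHom
    (uniformContinuous_mapLeft f hf).continuous

theorem completedMapLeft_coe (f : Module.End F C) (hf : Continuous f) (x : Tensor F C A) :
    completedMapLeft f hf (toCompleted F C A x) = toCompleted F C A (mapLeft f x) :=
  UniformSpace.Completion.map_coe (uniformContinuous_mapLeft f hf) x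

theorem mapLeft_mul_tmul (f : Module.End F C) (a : A) (x : Tensor F C A) :
    mapLeft f (tmul F 1 a * x) = tmul F 1 a * mapLeft f x := by
  induction x using tensor_induction with
  | zero => rw [map_zero, mul_zero, map_zero]
  | tmul c b =>
    have h : ∀ d : C, tmul F 1 a * tmul F d b = tmul F d (a * b) := fun d =>
      (Algebra.TensorProduct.tmul_mul_tmul 1 d a b).trans (by rw [one_mul]; rfl)
    have h' : ∀ (d : C) (e : A), mapLeft f (tmul F d e) = tmul F (f d) e := fun d e =>
      LinearMap.rTensor_tmul A f e d
    rw [h, h', h', h]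
  | add x y hx hy => rw [mul_add, map_add, map_add, mul_add, hx, hy]

theorem completedMapLeft_smul (f : Module.End F C) (hf : Continuous f) (a : A)
    (ω : CompletedTensor F C A) :
    completedMapLeft f hf (a • ω) = a • completedMapLeft f hf ω := by
  have hc : Continuous (completedMapLeft f hf : CompletedTensor F C A → CompletedTensor F C A) :=
    UniformSpace.Completion.continuous_map
  have hs : ∀ ω : CompletedTensor F C A, a • ω = toCompleted F C A (tmul F 1 a) * ω :=
    fun ω => Algebra.smul_def a ω
  refine UniformSpace.Completion.induction_on
    (p := fun ω : CompletedTensor F C A =>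
      completedMapLeft f hf (a • ω) = a • completedMapLeft f hf ω) ω ?_ fun x => ?_
  · simp only [hs]
    exact isClosed_eq (hc.comp (continuous_const.mul continuous_id)) (continuous_const.mul hc)
  · change completedMapLeft f hf (a • toCompleted F C A x) =
      a • completedMapLeft f hf (toCompleted F C A x)
    rw [hs, hs, ← map_mul, completedMapLeft_coe, completedMapLeft_coe, mapLeft_mul_tmul, map_mul]

/-- The extension of the contraction by `χ` to `C ⊗̂ A` (for complete `C`). Letting `χ` vary, it
identifies `C ⊗̂ A` with the continuous linear maps from the dual of `A` to `C`. -/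
def completedContract (χ : Module.Dual F A) : CompletedTensor F C A → C :=
  UniformSpace.Completion.extension (contract χ : Tensor F C A → C)

theorem uniformContinuous_contract (χ : Module.Dual F A) :
    UniformContinuous (contract χ : Tensor F C A → C) :=
  (AddMonoidHomClass.lipschitz_of_bound (contract χ : Tensor F C A →ₗ[F] C) 1
    (fun x => by rw [one_mul]; exact norm_contract_le χ x)).uniformContinuous

end Tensor

/-! ### Curves with a rational point, in terms of their function fields -/

/-- `K` is the function field of a smooth projective geometrically irreducible curve over the
finite (hence perfect) field `F`: it is a finite extension of some `F(t)` with `t` transcendental,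
and `F` is algebraically closed in `K`. -/
class IsCurveFunctionField (F K : Type*) [Field F] [Field K] [Algebra F K] : Prop where
  exists_finite : ∃ t : K, Transcendental F t ∧
    FiniteDimensional (IntermediateField.adjoin F {t}) K
  mem_range_of_isAlgebraic : ∀ x : K, IsAlgebraic F x → x ∈ (algebraMap F K).range

/-- A rational point `∞` of the curve with function field `K`, given by its normalized valuation
(written multiplicatively), whose residue field is `F`. -/
structure RationalPoint (F K : Type*) [Field F] [Field K] [Algebra F K] where
  /-- The normalized valuation at the point. -/
  val : Valuation K ℤᵐ⁰
  surjective : Function.Surjective val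
  residue : ∀ x : K, val x ≤ 1 → ∃ c : F, val (x - algebraMap F K c) < 1

variable {F K : Type*} [Field F] [Finite F] [Field K] [Algebra F K]

theorem isIntegral_algebraMap_int (r : F) : IsIntegral ℤ (algebraMap F K r) := by
  rcases eq_or_ne r 0 with rfl | hr
  · simpa using isIntegral_zero
  · have : IsOfFinOrder (Units.mk0 r hr) := isOfFinOrder_of_finite _
    obtain ⟨n, hn, h⟩ := isOfFinOrder_iff_pow_eq_one.mp this
    have h' : r ^ n = 1 := by simpa using congrArg Units.val h
    refine IsIntegral.of_pow hn ?_
    rw [← map_pow, h', map_one]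
    exact isIntegral_one

theorem algebraMap_mem_valuationSubring (O : ValuationSubring K) (r : F) :
    algebraMap F K r ∈ O := by
  have h : IsIntegral O (algebraMap F K r) := (isIntegral_algebraMap_int r).tower_top
  obtain ⟨y, hy⟩ := IsIntegrallyClosed.isIntegral_iff.mp h
  rw [← hy]
  exact y.2

namespace RationalPoint

variable (P : RationalPoint F K)

/-- The ring `A` of functions that are regular away from `∞`. The points of the curve other than
the generic one are the valuation subrings of `K` other than `K` (all of them contain `F`, and
including `K` itself does not change the intersection). -/
def A : Subalgebra F K where
  carrier := {x | ∀ O : ValuationSubring K, O ≠ P.val.valuationSubring → x ∈ O}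
  mul_mem' hx hy O hO := mul_mem (hx O hO) (hy O hO)
  add_mem' hx hy O hO := add_mem (hx O hO) (hy O hO)
  algebraMap_mem' r O _ := algebraMap_mem_valuationSubring O r

/-- The degree of a nonzero `a`, the opposite of its (additive) valuation at `∞`. -/
def deg (a : P.A) : ℤ := WithZero.log (P.val (a : K))

theorem one_lt_card : 1 < (Nat.card F : ℝ≥0) := by
  exact_mod_cast Finite.one_lt_card (α := F)

/-- The `∞`-adic absolute value, `‖a‖ = q ^ deg a`. -/
def abv : AbsoluteValue K ℝ where
  toFun x := WithZeroMulInt.toNNReal (one_lt_card (F := F)).ne_zero (P.val x)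
  map_mul' x y := by simp
  nonneg' x := NNReal.coe_nonneg _
  eq_zero' x := by simp
  add_le' x y := by
    have hm := (WithZeroMulInt.toNNReal_strictMono (one_lt_card (F := F))).monotone
    have h := hm (P.val.map_add x y)
    rw [hm.map_max] at h
    exact_mod_cast h.trans (max_le_add_of_nonneg zero_le zero_le)

theorem abv_add_le_max (x y : K) : P.abv (x + y) ≤ max (P.abv x) (P.abv y) := by
  have hm := (WithZeroMulInt.toNNReal_strictMono (one_lt_card (F := F))).monotone
  have h := hm (P.val.map_add x y)
  rw [hm.map_max] at h
  exact_mod_cast h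

instance : IsUltrametricDist (WithAbs P.abv) :=
  IsUltrametricDist.isUltrametricDist_of_forall_norm_add_le_max_norm fun x y =>
    P.abv_add_le_max x.ofAbs y.ofAbs

/-- `K∞`, the completion of `K` at `∞`. -/
abbrev Kinf : Type _ := P.abv.Completion

instance : IsUltrametricDist P.Kinf := isUltrametricDist_completion _

instance : NontriviallyNormedField P.Kinf where
  non_trivial := by
    obtain ⟨x, hx⟩ := P.surjective (WithZero.exp (1 : ℤ))
    refine ⟨((WithAbs.toAbs P.abv x : WithAbs P.abv) : P.Kinf), ?_⟩
    rw [UniformSpace.Completion.norm_coe]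
    change 1 < P.abv x
    have hm := WithZeroMulInt.toNNReal_strictMono (one_lt_card (F := F))
    have h1 : (1 : ℤᵐ⁰) < P.val x := by
      rw [hx, ← WithZero.exp_zero]
      exact WithZero.exp_lt_exp.mpr one_pos
    have h := hm h1
    rw [map_one] at h
    exact_mod_cast h

/-- An algebraic closure of `K∞`. -/
def KinfAlgCl : Type _ := AlgebraicClosure P.Kinf

instance : Field P.KinfAlgCl := inferInstanceAs (Field (AlgebraicClosure P.Kinf))

instance : Algebra P.Kinf P.KinfAlgCl :=
  inferInstanceAs (Algebra P.Kinf (AlgebraicClosure P.Kinf))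

instance : IsAlgClosure P.Kinf P.KinfAlgCl :=
  inferInstanceAs (IsAlgClosure P.Kinf (AlgebraicClosure P.Kinf))

instance : Algebra.IsAlgebraic P.Kinf P.KinfAlgCl := IsAlgClosure.isAlgebraic

/-- The unique extension of the absolute value of `K∞`. -/
instance : NormedField P.KinfAlgCl := spectralNorm.normedField P.Kinf P.KinfAlgCl

instance : IsUltrametricDist P.KinfAlgCl :=
  IsUltrametricDist.isUltrametricDist_of_forall_norm_add_le_max_norm
    (isNonarchimedean_spectralNorm (K := P.Kinf) (L := P.KinfAlgCl))

/-- `C∞`, the completion of the algebraic closure of `K∞`. -/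
def Cinf : Type _ := UniformSpace.Completion P.KinfAlgCl

instance : NormedField P.Cinf := inferInstanceAs (NormedField (UniformSpace.Completion _))

instance : CompleteSpace P.Cinf := inferInstanceAs (CompleteSpace (UniformSpace.Completion _))

instance : IsUltrametricDist P.Cinf := isUltrametricDist_completion _

/-- The inclusion of `K` into `C∞`. -/
def toCinf : K →+* P.Cinf :=
  ((UniformSpace.Completion.coeRingHom : P.KinfAlgCl →+* UniformSpace.Completion P.KinfAlgCl).comp
    (algebraMap P.Kinf P.KinfAlgCl)).comp
      ((UniformSpace.Completion.coeRingHom : WithAbs P.abv →+* P.Kinf).comp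
        (WithAbs.equiv P.abv).symm.toRingHom)

instance : Algebra F P.Cinf := (P.toCinf.comp (algebraMap F K)).toAlgebra

end RationalPoint

/-! ### Drinfeld modules and special functions -/

/-- A Drinfeld module of rank `r`: a ring homomorphism `φ` from `A` to the endomorphisms of the
`F`-vector space `C∞` such that, for `a ≠ 0`, `φ_a` is a polynomial `∑ pᵢ τⁱ` in the Frobenius
endomorphism `τ(x) = x ^ q`, of degree `r · deg a` in `τ` and with constant term `a`. -/
structure DrinfeldModule (P : RationalPoint F K) (r : ℕ) where
  /-- The underlying ring homomorphism. -/
  hom : P.A →+* Module.End F P.Cinf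
  exists_poly : ∀ a : P.A, a ≠ 0 → ∃ p : Polynomial P.Cinf,
    (p.natDegree : ℤ) = r * P.deg a ∧ p.coeff 0 = P.toCinf a ∧
      ∀ x : P.Cinf, hom a x = ∑ i ∈ Finset.range (p.natDegree + 1), p.coeff i * x ^ Nat.card F ^ i

namespace DrinfeldModule

variable {P : RationalPoint F K} {r : ℕ} (φ : DrinfeldModule P r)

theorem continuous_hom (a : P.A) : Continuous (φ.hom a) := by
  rcases eq_or_ne a 0 with rfl | ha
  · rw [map_zero]; exact continuous_zero
  · obtain ⟨p, -, -, hp⟩ := φ.exists_poly a ha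
    have : (φ.hom a : P.Cinf → P.Cinf) = fun x =>
        ∑ i ∈ Finset.range (p.natDegree + 1), p.coeff i * x ^ Nat.card F ^ i := funext hp
    rw [this]
    fun_prop

/-- The `A`-module `Sf_φ(A)` of special functions: the `ω` in `C∞ ⊗̂ A` with
`φ_a(ω) = (1 ⊗ a) ω` for all `a` in `A`. -/
def specialFunctions : Submodule P.A (CompletedTensor F P.Cinf P.A) where
  carrier := {ω | ∀ a : P.A, completedMapLeft (φ.hom a) (φ.continuous_hom a) ω = a • ω}
  add_mem' hx hy a := by rw [map_add, hx a, hy a, smul_add]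
  zero_mem' a := by rw [map_zero, smul_zero]
  smul_mem' b ω hω a := by rw [completedMapLeft_smul, hω a, smul_comm]

end DrinfeldModule

end SpecialFunctions

end

/-!
An element `ω` of `C ⊗̂ A` amounts to the linear map `χ ↦ χ(ω)` on the dual of `A`, and `ω` is
special if and only if `φ_a (χ(ω)) = (χ ∘ a)(ω)` for all `a` and `χ`. If `ω` generates the special
functions, this map is injective: the forms that it kills are those vanishing on an ideal of `A`,
and if this ideal were proper, some `s • ω` with `t ∤ s` would be `t` times a special function.

By injectivity the `q ^ deg a` forms `χ` with `χ ∘ a = 0` give as many zeros of `φ_a`, which are all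
of them because the rank is one. Let `N(v)` be the minimum of `‖χ(ω)‖` over the forms `χ` with
`χ(v) ≠ 0`. The factorization of `φ_a` shows that `N(v)` is a strictly increasing function of
`N(a v)`. Hence the order opposite to that of `N` comes from a valuation on `A`. It has finite
balls, so it is unbounded on powers of a nonconstant function, and by the definition of `A` it is
then equivalent to the valuation at `∞`: `N` is a strictly decreasing function of the degree.

A form `χ` vanishing in degrees below `deg w` satisfies `‖χ(ω)‖ ≤ N(w)`. For coordinate forms this
gives the monotonicity. For the forms with `χ(1) = 0` it makes the constant coefficient of `ω`
dominant, so that a geometric series inverts `ω`.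
-/

open scoped TensorProduct WithZero NNReal ENNReal

noncomputable section

namespace SpecialFunctions

/-! ### Linear forms on the completed tensor product -/

theorem dualCoannihilator_dualAnnihilator_eq_of_dualAnnihilator_le {k V : Type*} [Field k]
    [AddCommGroup V] [Module k V] {W : Submodule k V} [FiniteDimensional k W]
    {B : Submodule k (Module.Dual k V)} (hB : W.dualAnnihilator ≤ B) :
    B.dualCoannihilator.dualAnnihilator = B := by
  refine le_antisymm (fun ψ hψ => by_contra fun hψB => ?_) B.le_dualCoannihilator_dualAnnihilator
  have hψW : W.dualRestrict ψ ∉ B.map W.dualRestrict := by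
    rintro ⟨χ, hχ, hχψ⟩
    have hmem : ψ - χ ∈ W.dualAnnihilator := by
      rw [← Submodule.dualRestrict_ker_eq_dualAnnihilator, LinearMap.mem_ker, map_sub, hχψ,
        sub_self]
    exact hψB (sub_add_cancel ψ χ ▸ B.add_mem (hB hmem) hχ)
  obtain ⟨f, hf, hfB⟩ := Submodule.exists_dual_map_eq_bot_of_notMem hψW inferInstance
  obtain ⟨v, rfl⟩ := (Module.evalEquiv k W).surjective f
  refine hf ((Submodule.mem_dualAnnihilator ψ).mp hψ v ?_)
  refine (Submodule.mem_dualCoannihilator _).mpr fun χ hχ => ?_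
  have hmem := Submodule.mem_map_of_mem (f := Module.evalEquiv k W v)
    (Submodule.mem_map_of_mem (f := W.dualRestrict) hχ)
  rwa [hfB] at hmem

theorem enorm_add_le_max {E : Type*} [SeminormedAddCommGroup E] [IsUltrametricDist E] (x y : E) :
    ‖x + y‖ₑ ≤ max ‖x‖ₑ ‖y‖ₑ := by
  simpa only [enorm, ← ENNReal.coe_max, ENNReal.coe_le_coe] using
    IsUltrametricDist.nnnorm_add_le_max x y

section Contraction

variable {F C A B : Type*} [Field F] [NormedField C] [Algebra F C] [CommRing A] [Algebra F A]
  [CommRing B] [Algebra F B]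

theorem tmul_mul_tmul (c d : C) (a b : A) :
    tmul F c a * tmul F d b = tmul F (c * d) (a * b) :=
  Algebra.TensorProduct.tmul_mul_tmul c d a b

/-- `id ⊗ π` on `C ⊗ A`, for an `F`-linear map `π : A → B`. -/
def mapRight (π : A →ₗ[F] B) : Tensor F C A →ₗ[F] Tensor F C B :=
  LinearMap.lTensor C π

theorem mapRight_tmul (π : A →ₗ[F] B) (c : C) (a : A) :
    mapRight π (tmul F c a) = tmul F c (π a) := LinearMap.lTensor_tmul C π c a

variable [Finite F] [IsUltrametricDist C]

theorem contract_add_left (χ ψ : Module.Dual F A) (x : Tensor F C A) :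
    contract (χ + ψ) x = contract χ x + contract ψ x := by
  induction x using tensor_induction with
  | zero => simp only [map_zero, add_zero]
  | tmul c a => simp only [contract_tmul, LinearMap.add_apply, add_smul]
  | add x y hx hy => rw [map_add, map_add, map_add, hx, hy]; abel

theorem contract_smul_left (r : F) (χ : Module.Dual F A) (x : Tensor F C A) :
    contract (r • χ) x = r • contract χ x := by
  induction x using tensor_induction with
  | zero => simp only [map_zero, smul_zero]
  | tmul c a => simp only [contract_tmul, LinearMap.smul_apply, smul_eq_mul, mul_smul]
  | add x y hx hy => rw [map_add, map_add, hx, hy, smul_add]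

theorem contract_one_tmul_mul (a : A) (χ : Module.Dual F A) (x : Tensor F C A) :
    contract χ (tmul F 1 a * x) = contract (χ ∘ₗ LinearMap.mulLeft F a) x := by
  induction x using tensor_induction with
  | zero => rw [mul_zero, map_zero, map_zero]
  | tmul c b => rw [tmul_mul_tmul, contract_tmul, contract_tmul, one_mul]; rfl
  | add x y hx hy => rw [mul_add, map_add, map_add, hx, hy]

theorem contract_mapRight (π : A →ₗ[F] B) (χ : Module.Dual F B) (x : Tensor F C A) :
    contract χ (mapRight π x) = contract (χ ∘ₗ π) x := by
  induction x using tensor_induction with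
  | zero => simp only [map_zero]
  | tmul c a => rw [mapRight_tmul, contract_tmul, contract_tmul]; rfl
  | add x y hx hy => rw [map_add, map_add, map_add, hx, hy]

theorem exists_finiteDimensional_contract_eq_zero (x : Tensor F C A) :
    ∃ W : Submodule F A, FiniteDimensional F W ∧
      ∀ χ : Module.Dual F A, (∀ v ∈ W, χ v = 0) → contract χ x = 0 := by
  induction x using tensor_induction with
  | zero => exact ⟨⊥, inferInstance, fun χ _ => map_zero _⟩
  | tmul c a =>
    refine ⟨F ∙ a, inferInstance, fun χ h => ?_⟩
    rw [contract_tmul, h a (Submodule.mem_span_singleton_self a), zero_smul]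
  | add x y hx hy =>
    obtain ⟨V, _, hV⟩ := hx
    obtain ⟨W, _, hW⟩ := hy
    refine ⟨V ⊔ W, inferInstance, fun χ h => ?_⟩
    rw [map_add, hV χ fun v hv => h v (Submodule.mem_sup_left hv),
      hW χ fun v hv => h v (Submodule.mem_sup_right hv), add_zero]

theorem uniformContinuous_mapRight (π : A →ₗ[F] B) :
    UniformContinuous (mapRight π : Tensor F C A → Tensor F C B) :=
  (AddMonoidHomClass.lipschitz_of_bound (mapRight π : Tensor F C A →ₗ[F] Tensor F C B) 1
    (fun x => by
      rw [one_mul]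
      refine tensor_norm_le fun χ => ?_
      rw [contract_mapRight]
      exact norm_contract_le _ x)).uniformContinuous

/-- The extension of `id ⊗ π` to `C ⊗̂ A`. -/
def completedMapRight (π : A →ₗ[F] B) : CompletedTensor F C A → CompletedTensor F C B :=
  UniformSpace.Completion.map (mapRight π : Tensor F C A → Tensor F C B)

theorem completedMapRight_coe (π : A →ₗ[F] B) (x : Tensor F C A) :
    completedMapRight π (toCompleted F C A x) = toCompleted F C B (mapRight π x) :=
  UniformSpace.Completion.map_coe (uniformContinuous_mapRight π) x

theorem completedTensor_induction {motive : CompletedTensor F C A → Prop}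
    (ω : CompletedTensor F C A) (closed : IsClosed {ω | motive ω})
    (coe : ∀ x : Tensor F C A, motive (toCompleted F C A x)) : motive ω :=
  UniformSpace.Completion.induction_on (p := motive) ω closed coe

theorem norm_toCompleted (x : Tensor F C A) : ‖toCompleted F C A x‖ = ‖x‖ :=
  UniformSpace.Completion.norm_coe x

theorem exists_norm_sub_toCompleted_lt (ω : CompletedTensor F C A) {ε : ℝ} (hε : 0 < ε) :
    ∃ x : Tensor F C A, ‖ω - toCompleted F C A x‖ < ε := by
  have hd : DenseRange (toCompleted F C A) :=
    UniformSpace.Completion.denseRange_coe (α := Tensor F C A)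
  obtain ⟨x, hx⟩ := Metric.denseRange_iff.mp hd ω ε hε
  exact ⟨x, by rwa [dist_eq_norm] at hx⟩

theorem smul_eq_toCompleted_mul (a : A) (ω : CompletedTensor F C A) :
    a • ω = toCompleted F C A (tmul F 1 a) * ω := Algebra.smul_def a ω

theorem continuous_completedMapLeft (f : Module.End F C) (hf : Continuous f) :
    Continuous (completedMapLeft f hf : CompletedTensor F C A → CompletedTensor F C A) :=
  UniformSpace.Completion.continuous_map

theorem completedContract_coe (χ : Module.Dual F A) (x : Tensor F C A) :
    completedContract χ (toCompleted F C A x) = contract χ x :=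
  UniformSpace.Completion.extension_coe (uniformContinuous_contract χ) x

theorem completedContract_zero (χ : Module.Dual F A) :
    completedContract χ (0 : CompletedTensor F C A) = 0 := by
  rw [← map_zero (toCompleted F C A), completedContract_coe, map_zero]

variable [CompleteSpace C]

theorem continuous_completedContract (χ : Module.Dual F A) :
    Continuous (completedContract χ : CompletedTensor F C A → C) :=
  UniformSpace.Completion.continuous_extension

theorem completedContract_add (χ : Module.Dual F A) (ω η : CompletedTensor F C A) :
    completedContract χ (ω + η) = completedContract χ ω + completedContract χ η := by
  have hc := continuous_completedContract (C := C) χ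
  induction ω using completedTensor_induction with
  | closed => exact isClosed_eq (by fun_prop) (by fun_prop)
  | coe x =>
    induction η using completedTensor_induction with
    | closed => exact isClosed_eq (by fun_prop) (by fun_prop)
    | coe y =>
      rw [← map_add, completedContract_coe, completedContract_coe, completedContract_coe, map_add]

theorem completedContract_sub (χ : Module.Dual F A) (ω η : CompletedTensor F C A) :
    completedContract χ (ω - η) = completedContract χ ω - completedContract χ η := by
  rw [eq_sub_iff_add_eq, ← completedContract_add, sub_add_cancel]

/-- An element `ω` of `C ⊗̂ A` as a linear map from the dual of `A` to `C`. -/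
def dualEval (ω : CompletedTensor F C A) : Module.Dual F A →ₗ[F] C where
  toFun χ := completedContract χ ω
  map_add' χ ψ := by
    have hc := fun χ => continuous_completedContract (F := F) (A := A) (C := C) χ
    induction ω using completedTensor_induction with
    | closed => exact isClosed_eq (hc _) ((hc _).add (hc _))
    | coe x => simp only [completedContract_coe, contract_add_left]
  map_smul' r χ := by
    have hc := fun χ => continuous_completedContract (F := F) (A := A) (C := C) χ
    induction ω using completedTensor_induction with
    | closed =>
      simp only [Algebra.smul_def]
      exact isClosed_eq (hc _) (continuous_const.mul (hc _))
    | coe x => simp only [completedContract_coe, contract_smul_left, RingHom.id_apply]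

theorem dualEval_apply (ω : CompletedTensor F C A) (χ : Module.Dual F A) :
    dualEval ω χ = completedContract χ ω := rfl

theorem norm_completedContract_le (χ : Module.Dual F A) (ω : CompletedTensor F C A) :
    ‖completedContract χ ω‖ ≤ ‖ω‖ := by
  have hc := continuous_completedContract (C := C) χ
  induction ω using completedTensor_induction with
  | closed => exact isClosed_le (by fun_prop) (by fun_prop)
  | coe x => rw [completedContract_coe, norm_toCompleted]; exact norm_contract_le χ x

theorem norm_le_of_forall_completedContract {ω : CompletedTensor F C A} {B : ℝ}
    (h : ∀ χ : Module.Dual F A, ‖completedContract χ ω‖ ≤ B) : ‖ω‖ ≤ B := by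
  refine le_of_forall_pos_le_add fun ε hε => ?_
  obtain ⟨x, hx⟩ := exists_norm_sub_toCompleted_lt ω (half_pos hε)
  have hx' : ‖x‖ ≤ B + ε / 2 := tensor_norm_le fun χ => by
    have h1 : contract χ x =
        completedContract χ ω - completedContract χ (ω - toCompleted F C A x) := by
      rw [completedContract_sub, completedContract_coe]; abel
    rw [h1]
    exact (norm_sub_le _ _).trans
      (add_le_add (h χ) ((norm_completedContract_le χ _).trans hx.le))
  calc ‖ω‖ = ‖(ω - toCompleted F C A x) + toCompleted F C A x‖ := by rw [sub_add_cancel]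
    _ ≤ ‖ω - toCompleted F C A x‖ + ‖toCompleted F C A x‖ := norm_add_le _ _
    _ ≤ B + ε := by rw [norm_toCompleted]; linarith

theorem completedTensor_ext {ω η : CompletedTensor F C A}
    (h : ∀ χ : Module.Dual F A, completedContract χ ω = completedContract χ η) : ω = η := by
  rw [← sub_eq_zero, ← norm_le_zero_iff]
  refine norm_le_of_forall_completedContract fun χ => ?_
  rw [completedContract_sub, h, sub_self, norm_zero]

theorem completedContract_completedMapLeft (f : Module.End F C) (hf : Continuous f)
    (χ : Module.Dual F A) (ω : CompletedTensor F C A) :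
    completedContract χ (completedMapLeft f hf ω) = f (completedContract χ ω) := by
  have hc := continuous_completedContract (C := C) χ
  induction ω using completedTensor_induction with
  | closed =>
    exact isClosed_eq (hc.comp (continuous_completedMapLeft f hf)) (hf.comp hc)
  | coe x => simp only [completedMapLeft_coe, completedContract_coe, contract_mapLeft]

theorem completedContract_smul (a : A) (χ : Module.Dual F A) (ω : CompletedTensor F C A) :
    completedContract χ (a • ω) = completedContract (χ ∘ₗ LinearMap.mulLeft F a) ω := by
  have hc := fun χ => continuous_completedContract (F := F) (A := A) (C := C) χ
  rw [smul_eq_toCompleted_mul]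
  induction ω using completedTensor_induction with
  | closed => exact isClosed_eq ((hc _).comp (continuous_const.mul continuous_id)) (hc _)
  | coe x => rw [← map_mul, completedContract_coe, completedContract_coe, contract_one_tmul_mul]

theorem completedContract_completedMapRight (π : A →ₗ[F] B) (χ : Module.Dual F B)
    (ω : CompletedTensor F C A) :
    completedContract χ (completedMapRight π ω) = completedContract (χ ∘ₗ π) ω := by
  have hm : Continuous (completedMapRight π : CompletedTensor F C A → CompletedTensor F C B) :=
    UniformSpace.Completion.continuous_map
  induction ω using completedTensor_induction with
  | closed =>
    exact isClosed_eq ((continuous_completedContract χ).comp hm) (continuous_completedContract _)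
  | coe x =>
    rw [completedMapRight_coe, completedContract_coe, completedContract_coe, contract_mapRight]

theorem exists_finiteDimensional_enorm_dualEval_lt (ω : CompletedTensor F C A) {ε : ℝ≥0∞}
    (hε : 0 < ε) : ∃ W : Submodule F A, FiniteDimensional F W ∧
      ∀ χ ∈ W.dualAnnihilator, ‖dualEval ω χ‖ₑ < ε := by
  obtain ⟨δ, hδ, hδε⟩ := ENNReal.lt_iff_exists_nnreal_btwn.mp hε
  obtain ⟨x, hx⟩ := exists_norm_sub_toCompleted_lt ω (NNReal.coe_pos.mpr (ENNReal.coe_pos.mp hδ))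
  obtain ⟨W, hW, h⟩ := exists_finiteDimensional_contract_eq_zero x
  refine ⟨W, hW, fun χ hχ => ?_⟩
  have hω : dualEval ω χ = completedContract χ (ω - toCompleted F C A x) := by
    rw [completedContract_sub, completedContract_coe,
      h χ ((Submodule.mem_dualAnnihilator χ).mp hχ), sub_zero, dualEval_apply]
  have hlt : ‖dualEval ω χ‖₊ < δ := hω ▸ (norm_completedContract_le _ _).trans_lt hx
  exact (ENNReal.coe_lt_coe.mpr hlt).trans hδε

/-- The linear forms `χ` whose image `χ(ω)` has norm at most `r`. -/
def dualBall (ω : CompletedTensor F C A) (r : ℝ≥0∞) : Submodule F (Module.Dual F A) where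
  carrier := {χ | ‖dualEval ω χ‖ₑ ≤ r}
  zero_mem' := by simp only [Set.mem_ofPred_eq, map_zero, enorm_zero, zero_le]
  add_mem' {χ ψ} hχ hψ := by
    rw [Set.mem_ofPred_eq, map_add]
    exact (enorm_add_le_max _ _).trans (max_le hχ hψ)
  smul_mem' c χ hχ := by
    rw [Set.mem_ofPred_eq, map_smul]
    exact (enorm_le_iff_norm_le.mpr (norm_smul_le' _ _)).trans hχ

theorem mem_dualBall {ω : CompletedTensor F C A} {r : ℝ≥0∞} {χ : Module.Dual F A} :
    χ ∈ dualBall ω r ↔ ‖dualEval ω χ‖ₑ ≤ r := Iff.rfl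

theorem dualBall_mono (ω : CompletedTensor F C A) : Monotone (dualBall ω) :=
  fun _ _ hrs _ hχ => le_trans hχ hrs

theorem dualCoannihilator_dualAnnihilator_dualBall (ω : CompletedTensor F C A) {r : ℝ≥0∞}
    (hr : 0 < r) : (dualBall ω r).dualCoannihilator.dualAnnihilator = dualBall ω r := by
  obtain ⟨W, _, hW⟩ := exists_finiteDimensional_enorm_dualEval_lt ω hr
  exact dualCoannihilator_dualAnnihilator_eq_of_dualAnnihilator_le (W := W) fun χ hχ => (hW χ hχ).le

theorem exists_dualEval_eq_zero (ω : CompletedTensor F C A) {v : A}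
    (h : ∀ r : ℝ≥0∞, 0 < r → ∃ χ : Module.Dual F A, χ v ≠ 0 ∧ ‖dualEval ω χ‖ₑ ≤ r) :
    ∃ χ : Module.Dual F A, χ v ≠ 0 ∧ dualEval ω χ = 0 := by
  let U : Set.Ioi (0 : ℝ≥0∞) → Submodule F A := fun r => (dualBall ω r).dualCoannihilator
  have hU : Antitone U := fun r s hrs =>
    Submodule.dualCoannihilator_anti (dualBall_mono ω hrs)
  have : Nonempty (Set.Ioi (0 : ℝ≥0∞)) := ⟨⟨1, Set.mem_Ioi.mpr one_pos⟩⟩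
  have hv : v ∉ ⨆ r, U r := by
    rw [Submodule.mem_iSup_of_directed U hU.directed_le]
    rintro ⟨⟨r, hr⟩, hvr⟩
    obtain ⟨χ, hχv, hχ⟩ := h r hr
    exact hχv ((Submodule.mem_dualCoannihilator v).mp hvr χ hχ)
  obtain ⟨χ, hχv, hχ⟩ := Submodule.exists_le_ker_of_notMem hv
  refine ⟨χ, hχv, enorm_eq_zero.mp (le_bot_iff.mp (le_of_forall_gt_imp_ge_of_dense fun r hr => ?_))⟩
  rw [← mem_dualBall, ← dualCoannihilator_dualAnnihilator_dualBall ω hr,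
    Submodule.mem_dualAnnihilator]
  exact fun w hw => hχ (Submodule.mem_iSup_of_mem (p := U) ⟨r, hr⟩ hw)

theorem finite_enorm_dualEval_ge (ω : CompletedTensor F C A) {ε : ℝ≥0∞} (hε : 0 < ε) :
    (Set.range (fun χ : Module.Dual F A => ‖dualEval ω χ‖ₑ) ∩ Set.Ici ε).Finite := by
  obtain ⟨W, _, hW⟩ := exists_finiteDimensional_enorm_dualEval_lt ω hε
  have : Finite (Module.Dual F W) := Module.finite_of_finite F
  obtain ⟨s, hs⟩ := (Subspace.dualRestrict_surjective (W := W)).hasRightInverse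
  refine (Set.finite_range fun f => ‖dualEval ω (s f)‖ₑ).subset ?_
  rintro _ ⟨⟨χ, rfl⟩, hχ⟩
  refine ⟨W.dualRestrict χ, ?_⟩
  have hmem : s (W.dualRestrict χ) - χ ∈ W.dualAnnihilator := by
    rw [← Submodule.dualRestrict_ker_eq_dualAnnihilator, LinearMap.mem_ker, map_sub, hs, sub_self]
  have hlt : ‖dualEval ω (s (W.dualRestrict χ) - χ)‖₊ < ‖dualEval ω χ‖₊ :=
    ENNReal.coe_lt_coe.mp ((hW _ hmem).trans_le hχ)
  have hmax := IsUltrametricDist.nnnorm_add_eq_max_of_nnnorm_ne_nnnorm hlt.ne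
  rw [← map_add, sub_add_cancel, max_eq_right hlt.le] at hmax
  exact congrArg ENNReal.ofNNReal hmax

theorem completedContract_sub_tmul_one (ω : CompletedTensor F C A) (χ₀ χ : Module.Dual F A) :
    completedContract χ (ω - toCompleted F C A (tmul F (dualEval ω χ₀) 1)) =
      dualEval ω (χ - χ 1 • χ₀) := by
  rw [completedContract_sub, completedContract_coe, contract_tmul, map_sub, map_smul]
  rfl

theorem isUnit_of_dominant {ω : CompletedTensor F C A} {χ₀ : Module.Dual F A} (h₀ : χ₀ 1 = 1)
    {r : ℝ} (hr : r < ‖dualEval ω χ₀‖)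
    (h : ∀ χ : Module.Dual F A, χ 1 = 0 → ‖dualEval ω χ‖ ≤ r) : IsUnit ω := by
  set c := dualEval ω χ₀
  have hr0 : 0 ≤ r := (norm_nonneg _).trans (h 0 rfl)
  have hc0 : 0 < ‖c‖ := hr0.trans_lt hr
  have hcne : c ≠ 0 := norm_pos_iff.mp hc0
  let T : C → CompletedTensor F C A := fun d => toCompleted F C A (tmul F d 1)
  have hT : T c⁻¹ * T c = 1 := by
    change toCompleted F C A _ * toCompleted F C A _ = 1
    rw [← map_mul, tmul_mul_tmul, inv_mul_cancel₀ hcne, one_mul]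
    exact map_one _
  have hrest : ‖ω - T c‖ ≤ r := norm_le_of_forall_completedContract fun χ => by
    rw [completedContract_sub_tmul_one]
    refine h _ ?_
    simp [h₀]
  have hTinv : ‖T c⁻¹‖ ≤ ‖c‖⁻¹ := by
    rw [← norm_inv]
    exact (norm_toCompleted _).trans_le (tensor_norm_tmul_le _ _)
  have hlt : ‖T c⁻¹ * (T c - ω)‖ < 1 := by
    refine (norm_mul_le _ _).trans_lt ?_
    rw [norm_sub_rev]
    calc ‖T c⁻¹‖ * ‖ω - T c‖ ≤ ‖c‖⁻¹ * r :=
          mul_le_mul hTinv hrest (norm_nonneg _) (inv_nonneg.mpr hc0.le)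
      _ < ‖c‖⁻¹ * ‖c‖ := by gcongr
      _ = 1 := inv_mul_cancel₀ hc0.ne'
  have hu := isUnit_one_sub_of_norm_lt_one hlt
  have he : 1 - T c⁻¹ * (T c - ω) = T c⁻¹ * ω := by rw [mul_sub, hT]; ring
  rw [he] at hu
  exact isUnit_of_mul_isUnit_right hu

end Contraction

/-! ### Minimal norms -/

section MinNorm

variable {F C A : Type*} [Field F] [Finite F] [NormedField C] [IsUltrametricDist C]
  [CompleteSpace C] [Algebra F C] [CommRing A] [Algebra F A]

/-- The minimal norm of `χ(ω)` over the linear forms `χ` that do not vanish at `v`; it is `⊤` for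
`v = 0`. -/
def minNorm (ω : CompletedTensor F C A) (v : A) : ℝ≥0∞ :=
  ⨅ χ : {χ : Module.Dual F A // χ v ≠ 0}, ‖dualEval ω χ‖ₑ

theorem minNorm_le (ω : CompletedTensor F C A) {v : A} {χ : Module.Dual F A} (hχ : χ v ≠ 0) :
    minNorm ω v ≤ ‖dualEval ω χ‖ₑ :=
  iInf_le (fun χ : {χ : Module.Dual F A // χ v ≠ 0} => ‖dualEval ω χ‖ₑ) ⟨χ, hχ⟩

theorem minNorm_zero (ω : CompletedTensor F C A) : minNorm ω 0 = ⊤ :=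
  iInf_eq_top.mpr fun χ => absurd (map_zero χ.1) χ.2

theorem exists_enorm_eq_minNorm (ω : CompletedTensor F C A) {v : A} (hv : v ≠ 0) :
    ∃ χ : Module.Dual F A, χ v ≠ 0 ∧ ‖dualEval ω χ‖ₑ = minNorm ω v := by
  rcases eq_zero_or_pos (minNorm ω v) with h0 | hpos
  · obtain ⟨χ, hχv, hχ⟩ := exists_dualEval_eq_zero ω (v := v) fun r hr => by
      obtain ⟨⟨χ, hχv⟩, hχ⟩ := iInf_lt_iff.mp (h0.trans_lt hr)
      exact ⟨χ, hχv, hχ.le⟩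
    exact ⟨χ, hχv, by rw [h0, hχ, enorm_zero]⟩
  · have : Nonempty {χ : Module.Dual F A // χ v ≠ 0} :=
      nonempty_subtype.mpr (Module.Projective.exists_dual_ne_zero F hv)
    have hfin : (Set.range fun χ : {χ : Module.Dual F A // χ v ≠ 0} => ‖dualEval ω χ‖ₑ).Finite := by
      refine (finite_enorm_dualEval_ge ω hpos).subset ?_
      rintro _ ⟨χ, rfl⟩
      exact ⟨⟨χ, rfl⟩, minNorm_le ω χ.2⟩
    obtain ⟨χ, hχ⟩ := (Set.range_nonempty _).csInf_mem hfin
    exact ⟨χ, χ.2, hχ⟩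

theorem minNorm_ne_top (ω : CompletedTensor F C A) {v : A} (hv : v ≠ 0) : minNorm ω v ≠ ⊤ := by
  obtain ⟨χ, -, hχ⟩ := exists_enorm_eq_minNorm ω hv
  exact hχ ▸ enorm_ne_top

theorem minNorm_pos {ω : CompletedTensor F C A} (hω : Function.Injective (dualEval ω)) (v : A) :
    0 < minNorm ω v := by
  rcases eq_or_ne v 0 with rfl | hv
  · exact minNorm_zero ω ▸ ENNReal.zero_lt_top
  · obtain ⟨χ, hχv, hχ⟩ := exists_enorm_eq_minNorm ω hv
    rw [← hχ, enorm_pos, ne_eq, map_eq_zero_iff _ hω]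
    rintro rfl
    exact hχv rfl

theorem min_minNorm_le_add (ω : CompletedTensor F C A) (v w : A) :
    min (minNorm ω v) (minNorm ω w) ≤ minNorm ω (v + w) := by
  refine le_iInf fun ⟨χ, hχ⟩ => ?_
  by_cases hv : χ v = 0
  · exact (min_le_right _ _).trans (minNorm_le ω fun hw => hχ (by rw [map_add, hv, hw, add_zero]))
  · exact (min_le_left _ _).trans (minNorm_le ω hv)

theorem minNorm_smul (ω : CompletedTensor F C A) {c : F} (hc : c ≠ 0) (v : A) :
    minNorm ω (c • v) = minNorm ω v :=
  (Equiv.subtypeEquivRight fun χ => by rw [map_smul, smul_ne_zero_iff_right hc]).iInf_congr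
    fun _ => rfl

theorem finite_le_minNorm (ω : CompletedTensor F C A) {r : ℝ≥0∞} (hr : 0 < r) :
    {v : A | r ≤ minNorm ω v}.Finite := by
  obtain ⟨W, _, hW⟩ := exists_finiteDimensional_enorm_dualEval_lt ω hr
  have : Finite W := Module.finite_of_finite F
  refine (Set.toFinite (W : Set A)).subset fun v hv => by_contra fun hvW => ?_
  obtain ⟨χ, hχv, hχW⟩ := Submodule.exists_le_ker_of_notMem hvW
  have hχ : χ ∈ W.dualAnnihilator := (Submodule.mem_dualAnnihilator χ).mpr fun w hw => hχW hw
  exact ((le_trans hv (minNorm_le ω hχv)).trans_lt (hW χ hχ)).false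

end MinNorm

section RootProduct

theorem eval_eq_leadingCoeff_mul_prod_of_card_eq {k : Type*} [Field k] {p : Polynomial k}
    (hp : p ≠ 0) {T : Finset k} (hcard : T.card = p.natDegree) (hT : ∀ t ∈ T, p.IsRoot t) (x : k) :
    p.eval x = p.leadingCoeff * ∏ t ∈ T, (x - t) := by
  have hle : T.val ≤ p.roots :=
    (Multiset.le_iff_subset T.nodup).mpr fun t ht => (Polynomial.mem_roots hp).mpr (hT t ht)
  have hroots : T.val = p.roots :=
    Multiset.eq_of_le_of_card_le hle (p.card_roots'.trans hcard.ge)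
  have hprod := Polynomial.C_leadingCoeff_mul_prod_multiset_X_sub_C (p := p)
    (by rw [← hroots]; exact hcard)
  conv_lhs => rw [← hprod, ← hroots, Polynomial.eval_mul, Polynomial.eval_C]
  congr 1
  exact (Polynomial.eval_prod T (fun t => Polynomial.X - Polynomial.C t) x).trans
    (by simp only [Polynomial.eval_sub, Polynomial.eval_X, Polynomial.eval_C])

/-- The `q`-polynomial `∑ pᵢ X ^ qⁱ` attached to `p = ∑ pᵢ Xⁱ`; if `p` is read as an operator in the
Frobenius `τ(x) = x ^ q`, this is the polynomial function that the operator induces. -/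
def qPolynomial {k : Type*} [Semiring k] (q : ℕ) (p : Polynomial k) : Polynomial k :=
  ∑ i ∈ Finset.range (p.natDegree + 1), Polynomial.C (p.coeff i) * Polynomial.X ^ q ^ i

variable {k : Type*} [Field k]

theorem eval_qPolynomial (q : ℕ) (p : Polynomial k) (x : k) :
    (qPolynomial q p).eval x = ∑ i ∈ Finset.range (p.natDegree + 1), p.coeff i * x ^ q ^ i := by
  simp only [qPolynomial, Polynomial.eval_finsetSum, Polynomial.eval_mul, Polynomial.eval_C,
    Polynomial.eval_pow, Polynomial.eval_X]

theorem coeff_qPolynomial_pow {q : ℕ} (hq : 1 < q) (p : Polynomial k) :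
    (qPolynomial q p).coeff (q ^ p.natDegree) = p.leadingCoeff := by
  rw [qPolynomial, Polynomial.finsetSum_coeff, Finset.sum_eq_single p.natDegree]
  · rw [Polynomial.coeff_C_mul_X_pow, if_pos rfl, Polynomial.coeff_natDegree]
  · intro i _ hi
    rw [Polynomial.coeff_C_mul_X_pow, if_neg fun h => hi (Nat.pow_right_injective hq h.symm)]
  · exact fun h => absurd (Finset.self_mem_range_succ _) h

theorem natDegree_qPolynomial {q : ℕ} (hq : 1 < q) {p : Polynomial k} (hp : p ≠ 0) :
    (qPolynomial q p).natDegree = q ^ p.natDegree := by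
  refine le_antisymm (Polynomial.natDegree_sum_le_of_forall_le _ _ fun i hi => ?_)
    (Polynomial.le_natDegree_of_ne_zero ?_)
  · exact (Polynomial.natDegree_C_mul_X_pow_le _ _).trans
      (Nat.pow_le_pow_right hq.le (Nat.lt_succ_iff.mp (Finset.mem_range.mp hi)))
  · rwa [coeff_qPolynomial_pow hq, Polynomial.leadingCoeff_ne_zero]

theorem leadingCoeff_qPolynomial {q : ℕ} (hq : 1 < q) {p : Polynomial k} (hp : p ≠ 0) :
    (qPolynomial q p).leadingCoeff = p.leadingCoeff := by
  rw [Polynomial.leadingCoeff, natDegree_qPolynomial hq hp, coeff_qPolynomial_pow hq]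

theorem enorm_prod {ι : Type*} {E : Type*} [NormedField E] (s : Finset ι) (f : ι → E) :
    ‖∏ i ∈ s, f i‖ₑ = ∏ i ∈ s, ‖f i‖ₑ := by
  simp only [enorm_eq_nnnorm, nnnorm_prod, ENNReal.ofNNReal_finsetProd]

theorem enorm_sub_eq_max_of_le {E : Type*} [SeminormedAddCommGroup E] [IsUltrametricDist E]
    {x t : E} (h : ‖x‖ₑ ≤ ‖x - t‖ₑ) : ‖x - t‖ₑ = max ‖x‖ₑ ‖t‖ₑ := by
  refine le_antisymm ?_ (max_le h ?_)
  · simpa only [sub_eq_add_neg, enorm_neg] using enorm_add_le_max x (-t)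
  · simpa only [sub_eq_add_neg, neg_add_rev, neg_neg, add_neg_cancel_comm_assoc, enorm_neg,
      ← sub_eq_add_neg, sub_sub_cancel, max_eq_left h, max_eq_right h] using
      enorm_add_le_max x (-(x - t))

theorem strictMono_mul_prod_max_enorm {E : Type*} [NormedAddCommGroup E] {T : Finset E}
    (h0 : 0 ∈ T) {l : ℝ≥0∞} (hl : l ≠ 0) (hl' : l ≠ ⊤) :
    StrictMono fun r : ℝ≥0∞ => l * ∏ t ∈ T, max r ‖t‖ₑ := by
  classical
  intro r s hrs
  have hmax (x : ℝ≥0∞) : max x 0 = x := max_eq_left zero_le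
  simp only [← Finset.mul_prod_erase T _ h0, enorm_zero, hmax]
  refine ENNReal.mul_lt_mul_right hl hl' ?_
  calc r * ∏ t ∈ T.erase 0, max r ‖t‖ₑ < s * ∏ t ∈ T.erase 0, max r ‖t‖ₑ := by
        refine ENNReal.mul_lt_mul_left (Finset.prod_ne_zero_iff.mpr fun t ht => ?_)
          (ENNReal.prod_ne_top fun t _ => max_ne_top hrs.ne_top enorm_ne_top) hrs
        exact (lt_max_of_lt_right (enorm_pos.mpr (Finset.ne_of_mem_erase ht))).ne'
    _ ≤ s * ∏ t ∈ T.erase 0, max s ‖t‖ₑ := by gcongr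

end RootProduct

/-! ### Degrees of functions -/

section Degree

theorem isIntegral_int_of_forall_mem_valuationSubring {K : Type*} [Field K] {x : K}
    (hx : ∀ V : ValuationSubring K, x ∈ V) : IsIntegral ℤ x := by
  have hbot : IsIntegral (⊥ : Subring K) x := by
    have hmem : x ∈ (integralClosure (Subring.closure (∅ : Set K)) K).toSubring := by
      rw [← iInf_valuationSubring_superset, Subring.mem_iInf]
      exact fun V => hx V.1
    rwa [Subring.closure_empty] at hmem
  have : Algebra.IsIntegral ℤ (⊥ : Subring K) := ⟨fun y => by
    obtain ⟨n, hn⟩ := Subring.mem_bot.mp y.2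
    exact (Subtype.ext hn : (n : (⊥ : Subring K)) = y) ▸ isIntegral_algebraMap⟩
  exact isIntegral_trans x hbot

theorem isAlgebraic_adjoin {F K : Type*} [Field F] [Field K] [Algebra F K]
    [IsCurveFunctionField F K] {t : K} (ht : Transcendental F t) :
    Algebra.IsAlgebraic (Algebra.adjoin F {t}) K := by
  obtain ⟨t₀, -, hfin⟩ := IsCurveFunctionField.exists_finite (F := F) (K := K)
  have halg : Algebra.IsAlgebraic (Algebra.adjoin F {t₀}) K :=
    ⟨fun x => IntermediateField.isAlgebraic_adjoin_iff.mp (Algebra.IsAlgebraic.isAlgebraic x)⟩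
  have htrdeg : Algebra.trdeg F K ≤ 1 := by
    simpa using Algebra.IsAlgebraic.trdeg_le_cardinalMk F ({t₀} : Set K)
  have hind : AlgebraicIndependent F (fun _ : Unit => t) :=
    algebraicIndependent_unique_type_iff.mpr ht
  have hbasis := hind.isTranscendenceBasis_of_lift_trdeg_le_of_finite (by simpa using htrdeg)
  have := hbasis.isAlgebraic
  rwa [Set.range_const] at this

namespace RationalPoint

variable {F K : Type*} [Field F] [Finite F] [Field K] [Algebra F K] {P : RationalPoint F K}

theorem val_ne_zero {a : P.A} (ha : a ≠ 0) : P.val (a : K) ≠ 0 :=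
  (Valuation.ne_zero_iff _).mpr fun h => ha (Subtype.ext h)

theorem deg_lt_deg_iff {a b : P.A} (ha : a ≠ 0) (hb : b ≠ 0) :
    P.deg a < P.deg b ↔ P.val (a : K) < P.val b :=
  WithZero.log_lt_log (val_ne_zero ha) (val_ne_zero hb)

theorem val_eq_val_of_deg_eq {a b : P.A} (ha : a ≠ 0) (hb : b ≠ 0) (h : P.deg a = P.deg b) :
    P.val (a : K) = P.val b := by
  rw [← WithZero.exp_log (val_ne_zero ha), ← WithZero.exp_log (val_ne_zero hb)]
  exact congrArg WithZero.exp h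

theorem deg_zero : P.deg 0 = 0 := by
  rw [deg, ZeroMemClass.coe_zero, map_zero, WithZero.log_zero]

theorem ne_zero_of_deg_pos {a : P.A} (ha : 0 < P.deg a) : a ≠ 0 :=
  fun h => (h ▸ ha).ne' deg_zero

theorem deg_mul {a b : P.A} (ha : a ≠ 0) (hb : b ≠ 0) : P.deg (a * b) = P.deg a + P.deg b := by
  rw [deg, MulMemClass.coe_mul, map_mul, WithZero.log_mul (val_ne_zero ha) (val_ne_zero hb), deg,
    deg]

theorem deg_pow (a : P.A) (n : ℕ) : P.deg (a ^ n) = n * P.deg a := by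
  rw [deg, SubmonoidClass.coe_pow, map_pow, WithZero.log_pow, nsmul_eq_mul, deg]

theorem deg_algebraMap (c : F) : P.deg (algebraMap F P.A c) = 0 := by
  rcases eq_or_ne c 0 with rfl | hc
  · rw [map_zero, deg_zero]
  · exact (congrArg WithZero.log (FiniteField.valuation_algebraMap_eq_one P.val c hc)).trans
      WithZero.log_one

theorem val_smul {c : F} (hc : c ≠ 0) (a : P.A) : P.val ((c • a : P.A) : K) = P.val a := by
  rw [Subalgebra.coe_smul, Algebra.smul_def, map_mul,
    FiniteField.valuation_algebraMap_eq_one P.val c hc, one_mul]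

theorem exists_val_sub_smul_lt {a b : P.A} (hb : b ≠ 0) (h : P.val (a : K) = P.val b) :
    ∃ c : F, P.val ((a - c • b : P.A) : K) < P.val b := by
  have hb' : (b : K) ≠ 0 := fun h => hb (Subtype.ext h)
  obtain ⟨c, hc⟩ := P.residue ((a : K) / b)
    (by rw [map_div₀, h, div_self (val_ne_zero hb)])
  refine ⟨c, ?_⟩
  have hab : ((a - c • b : P.A) : K) = ((a : K) / b - algebraMap F K c) * b := by
    rw [Subalgebra.coe_sub, Subalgebra.coe_smul, Algebra.smul_def, sub_mul, div_mul_cancel₀ _ hb']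
  rw [hab, map_mul]
  exact mul_lt_of_lt_one_left (zero_lt_iff.mpr (val_ne_zero hb)) hc

theorem mem_A_of_isIntegral {S : Subalgebra F K} (hS : S ≤ P.A) {x : K} (hx : IsIntegral S x) :
    x ∈ P.A := by
  intro O hO
  have hSO : ∀ y ∈ S, y ∈ O := fun y hy => hS hy O hO
  have hO : IsIntegral O x := by
    obtain ⟨p, hp, hpx⟩ := hx
    let f : S →+* O := (algebraMap S K).codRestrict O.toSubring fun y => hSO y y.2
    exact ⟨p.map f, hp.map _, by rwa [Polynomial.eval₂_map]⟩
  obtain ⟨y, rfl⟩ := IsIntegrallyClosed.isIntegral_iff.mp hO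
  exact y.2

section Curve

variable [IsCurveFunctionField F K]

theorem eq_zero_of_val_lt_one {a : P.A} (h : P.val (a : K) < 1) : a = 0 := by
  have hintegral : IsIntegral ℤ (a : K) := isIntegral_int_of_forall_mem_valuationSubring fun V => by
    by_cases hV : V = P.val.valuationSubring
    · exact hV ▸ h.le
    · exact a.2 V hV
  obtain ⟨c, hc⟩ := IsCurveFunctionField.mem_range_of_isAlgebraic (F := F) _
    hintegral.tower_top.isAlgebraic
  have hc0 : c = 0 := by
    by_contra hc0
    rw [← hc, FiniteField.valuation_algebraMap_eq_one P.val c hc0] at h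
    exact h.false
  exact Subtype.ext (by rw [← hc, hc0, map_zero, ZeroMemClass.coe_zero])

theorem deg_nonneg (a : P.A) : 0 ≤ P.deg a := by
  rcases eq_or_ne a 0 with rfl | ha
  · exact deg_zero.ge
  · have h1 : (1 : ℤᵐ⁰) ≤ P.val (a : K) := not_lt.mp fun h => ha (eq_zero_of_val_lt_one h)
    exact WithZero.log_one.symm.le.trans ((WithZero.log_le_log one_ne_zero (val_ne_zero ha)).mpr h1)

theorem exists_eq_algebraMap_of_deg_eq_zero {a : P.A} (h : P.deg a = 0) :
    ∃ c : F, a = algebraMap F P.A c := by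
  rcases eq_or_ne a 0 with rfl | ha
  · exact ⟨0, (map_zero _).symm⟩
  have hval : P.val (a : K) = P.val ((1 : P.A) : K) :=
    val_eq_val_of_deg_eq ha one_ne_zero (h.trans (by rw [← map_one (algebraMap F P.A),
      deg_algebraMap]))
  obtain ⟨c, hc⟩ := exists_val_sub_smul_lt one_ne_zero hval
  rw [OneMemClass.coe_one, map_one] at hc
  exact ⟨c, (sub_eq_zero.mp (eq_zero_of_val_lt_one hc)).trans
    (Algebra.algebraMap_eq_smul_one c).symm⟩

theorem transcendental_of_deg_pos {a : P.A} (ha : 0 < P.deg a) : Transcendental F (a : K) := by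
  intro halg
  obtain ⟨c, hc⟩ := IsCurveFunctionField.mem_range_of_isAlgebraic _ halg
  have hac : algebraMap F P.A c = a := Subtype.ext hc
  exact ha.ne' (hac ▸ deg_algebraMap c)

theorem isFractionRing_A {a : P.A} (ha : 0 < P.deg a) : IsFractionRing P.A K := by
  refine IsFractionRing.of_field P.A K fun x => ?_
  have := isAlgebraic_adjoin (transcendental_of_deg_pos ha)
  have hle : Algebra.adjoin F {(a : K)} ≤ P.A :=
    Algebra.adjoin_le (Set.singleton_subset_iff.mpr a.2)
  obtain ⟨y, hy, hintegral⟩ := (Algebra.IsAlgebraic.isAlgebraic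
    (R := Algebra.adjoin F {(a : K)}) x).exists_integral_multiple
  refine ⟨⟨y • x, mem_A_of_isIntegral hle hintegral⟩, ⟨y, hle y.2⟩, ?_⟩
  exact (mul_div_cancel_left₀ x fun h : (y : K) = 0 => hy (Subtype.ext h)).symm

theorem exists_deg_modEq {a : P.A} (ha : 0 < P.deg a) (k : ℤ) :
    ∃ b : P.A, b ≠ 0 ∧ P.deg b ≡ k [ZMOD P.deg a] := by
  have := isFractionRing_A ha
  obtain ⟨x, hx⟩ := P.surjective (WithZero.exp k)
  obtain ⟨b, c, hc, rfl⟩ := IsFractionRing.div_surjective (A := P.A) x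
  have hc0 : c ≠ 0 := nonZeroDivisors.ne_zero hc
  have hb0 : b ≠ 0 := by
    rintro rfl
    rw [map_zero, zero_div, map_zero] at hx
    exact WithZero.exp_ne_zero hx.symm
  have hk : P.deg b = k + P.deg c := by
    rw [map_div₀] at hx
    exact (congrArg WithZero.log ((div_eq_iff (val_ne_zero hc0)).mp hx)).trans
      (WithZero.log_mul WithZero.exp_ne_zero (val_ne_zero hc0))
  obtain ⟨d, hd⟩ := Int.eq_ofNat_of_zero_le ha.le
  refine ⟨b * c ^ (d - 1), mul_ne_zero hb0 (pow_ne_zero _ hc0), ?_⟩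
  have hd1 : ((d - 1 : ℕ) : ℤ) = P.deg a - 1 := by omega
  rw [deg_mul hb0 (pow_ne_zero _ hc0), deg_pow, hk, hd1]
  exact Int.modEq_iff_dvd.mpr ⟨-P.deg c, by ring⟩

end Curve

end RationalPoint

end Degree

/-! ### Quotients of `A` by principal ideals -/

section Quotient

theorem exists_valuation_sum_eq_of_injOn {L Γ ι : Type*} [Ring L]
    [LinearOrderedCommGroupWithZero Γ] (v : Valuation L Γ) {s : Finset ι} (hs : s.Nonempty)
    {f : ι → L} (h0 : ∀ i ∈ s, v (f i) ≠ 0) (hinj : Set.InjOn (fun i => v (f i)) s) :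
    ∃ i ∈ s, v (∑ j ∈ s, f j) = v (f i) ∧ ∀ j ∈ s, v (f j) ≤ v (f i) := by
  classical
  obtain ⟨i, hi, hmax⟩ := s.exists_max_image (fun i => v (f i)) hs
  refine ⟨i, hi, ?_, hmax⟩
  rw [← Finset.add_sum_erase s f hi]
  refine Valuation.map_add_eq_of_lt_left _ (Valuation.map_sum_lt _ (h0 i hi) fun j hj => ?_)
  obtain ⟨hji, hj⟩ := Finset.mem_erase.mp hj
  exact lt_of_le_of_ne (hmax j hj) fun h => hji (hinj hj hi h)

-- In each residue class modulo `d`, the least element of `S` is the only one outside `S + d`.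
theorem encard_diff_image_add_eq {S : Set ℤ} {d : ℕ} (hd : 0 < d) (hbdd : BddBelow S)
    (hadd : ∀ n ∈ S, n + d ∈ S) (hres : ∀ k : ℤ, ∃ n ∈ S, n ≡ k [ZMOD d]) :
    (S \ (· + (d : ℤ)) '' S).encard = d := by
  have hmul : ∀ n ∈ S, ∀ j : ℕ, n + d * j ∈ S := fun n hn j => by
    induction j with
    | zero => simpa using hn
    | succ j ih =>
      rw [Nat.cast_succ, mul_add_one, ← add_assoc]
      exact hadd _ ih
  have hinj : Set.InjOn (Int.cast : ℤ → ZMod d) (S \ (· + (d : ℤ)) '' S) := by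
    intro n hn m hm hnm
    wlog hlt : n < m generalizing n m
    · by_contra hne
      exact hne (this hm hn hnm.symm ((not_lt.mp hlt).lt_of_ne' hne)).symm
    obtain ⟨k, hk⟩ := (ZMod.intCast_eq_intCast_iff_dvd_sub n m d).mp hnm
    have hk0 : 0 < k := pos_of_mul_pos_right (hk ▸ sub_pos.mpr hlt) (Nat.cast_nonneg d)
    obtain ⟨j, rfl⟩ := Int.eq_succ_of_zero_lt hk0
    refine absurd ⟨_, hmul n hn.1 j, ?_⟩ hm.2
    rw [eq_add_of_sub_eq' hk]
    ring
  have himage : (Int.cast : ℤ → ZMod d) '' (S \ (· + (d : ℤ)) '' S) = Set.univ := by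
    refine Set.eq_univ_of_forall fun z => ?_
    obtain ⟨k, rfl⟩ := ZMod.intCast_surjective z
    obtain ⟨b, hb⟩ := hbdd
    obtain ⟨n, ⟨hnS, hnk⟩, hmin⟩ := Int.exists_least_of_bdd (P := fun n => n ∈ S ∧ n ≡ k [ZMOD d])
      ⟨b, fun n hn => hb hn.1⟩ (hres k)
    refine ⟨n, ⟨hnS, ?_⟩, (ZMod.intCast_eq_intCast_iff n k d).mpr hnk⟩
    rintro ⟨m, hm, rfl⟩
    exact (lt_add_of_pos_right m (Nat.cast_pos.mpr hd)).not_ge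
      (hmin m ⟨hm, Int.add_modEq_right.symm.trans hnk⟩)
  have : NeZero d := ⟨hd.ne'⟩
  rw [← hinj.encard_image, himage, Set.encard_univ, ENat.card_eq_coe_natCard, Nat.card_zmod]

namespace RationalPoint

variable {F K : Type*} [Field F] [Finite F] [Field K] [Algebra F K] {P : RationalPoint F K}

theorem exists_deg_linearCombination_eq {ι : Type*} {b : ι → P.A} (hb : ∀ i, b i ≠ 0)
    (hinj : Function.Injective fun i => P.deg (b i)) {c : ι →₀ F} (hc : c ≠ 0) :
    ∃ i, Finsupp.linearCombination F b c ≠ 0 ∧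
      P.deg (Finsupp.linearCombination F b c) = P.deg (b i) ∧
        ∀ j ∈ c.support, P.deg (b j) ≤ P.deg (b i) := by
  have hval : ∀ j ∈ c.support, P.val ((c j • b j : P.A) : K) = P.val (b j) := fun j hj =>
    val_smul (Finsupp.mem_support_iff.mp hj) _
  have hinj' : Set.InjOn (fun j => P.val ((c j • b j : P.A) : K)) c.support := by
    intro j hj k hk hjk
    refine hinj (congrArg WithZero.log ?_)
    rw [← hval j hj, ← hval k hk]
    exact hjk
  obtain ⟨i, hi, hsum, hmax⟩ := exists_valuation_sum_eq_of_injOn P.val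
    (Finsupp.support_nonempty_iff.mpr hc) (fun j hj => by rw [hval j hj]; exact val_ne_zero (hb j))
    hinj'
  have hlin : P.val (Finsupp.linearCombination F b c : P.A) = P.val (b i) := by
    rw [Finsupp.linearCombination_apply, Finsupp.sum, AddSubmonoidClass.coe_finsetSum, hsum,
      hval i hi]
  refine ⟨i, fun h0 => val_ne_zero (hb i) ?_, congrArg WithZero.log hlin, fun j hj => ?_⟩
  · rw [← hlin, h0, ZeroMemClass.coe_zero, map_zero]
  · refine (WithZero.log_le_log (val_ne_zero (hb j)) (val_ne_zero (hb i))).mpr ?_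
    rw [← hval j hj, ← hval i hi]
    exact hmax j hj

/-- The set of degrees of the nonzero elements of `W`. -/
def degrees (W : Submodule F P.A) : Set ℤ := P.deg '' ((W : Set P.A) \ {0})

theorem deg_mem_degrees {W : Submodule F P.A} {a : P.A} (haW : a ∈ W) (ha : a ≠ 0) :
    P.deg a ∈ degrees W :=
  ⟨a, ⟨haW, ha⟩, rfl⟩

theorem degrees_span_singleton {a : P.A} (ha : a ≠ 0) :
    degrees ((Ideal.span {a}).restrictScalars F) =
      (· + P.deg a) '' degrees (⊤ : Submodule F P.A) := by
  ext n
  constructor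
  · rintro ⟨_, ⟨hx, hx0⟩, rfl⟩
    obtain ⟨y, rfl⟩ := Ideal.mem_span_singleton'.mp hx
    have hy : y ≠ 0 := left_ne_zero_of_mul hx0
    exact ⟨P.deg y, deg_mem_degrees Submodule.mem_top hy, (deg_mul hy ha).symm⟩
  · rintro ⟨_, ⟨y, ⟨-, hy⟩, rfl⟩, rfl⟩
    exact ⟨y * a, ⟨Ideal.mem_span_singleton'.mpr ⟨y, rfl⟩, mul_ne_zero hy ha⟩, deg_mul hy ha⟩

section Curve

variable [IsCurveFunctionField F K]

theorem eq_top_of_degrees_top_subset {U : Submodule F P.A}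
    (hU : degrees (⊤ : Submodule F P.A) ⊆ degrees U) : U = ⊤ := by
  rw [eq_top_iff]
  suffices h : ∀ (n : ℕ) (a : P.A), P.deg a < n → a ∈ U from fun a _ =>
    h ((P.deg a).toNat + 1) a (by have := Int.self_le_toNat (P.deg a); omega)
  intro n
  induction n with
  | zero => exact fun a ha => absurd ha (deg_nonneg a).not_gt
  | succ n ih =>
    intro a ha
    rcases eq_or_ne a 0 with rfl | ha0
    · exact zero_mem U
    obtain ⟨b, ⟨hbU, hb0⟩, hba⟩ := hU (deg_mem_degrees Submodule.mem_top ha0)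
    obtain ⟨c, hc⟩ := exists_val_sub_smul_lt hb0 (val_eq_val_of_deg_eq ha0 hb0 hba.symm)
    refine (Submodule.sub_mem_iff_left U (U.smul_mem c hbU)).mp ?_
    rcases eq_or_ne (a - c • b) 0 with h0 | h0
    · exact h0 ▸ zero_mem U
    · refine ih _ ?_
      have := (deg_lt_deg_iff h0 hb0).mpr hc
      omega

theorem nonempty_basis_quotient (W : Submodule F P.A) :
    Nonempty (Module.Basis ↥(degrees (⊤ : Submodule F P.A) \ degrees W) F (P.A ⧸ W)) := by
  choose b hb hdeg using fun n : ↥(degrees (⊤ : Submodule F P.A) \ degrees W) => n.2.1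
  have hinj : Function.Injective fun n => P.deg (b n) := fun n m h =>
    Subtype.ext (by rw [← hdeg n, ← hdeg m]; exact h)
  have hli : LinearIndependent F (W.mkQ ∘ b) := by
    refine linearIndependent_iff.mpr fun c hc => by_contra fun hc0 => ?_
    obtain ⟨n, hne, hn, -⟩ := exists_deg_linearCombination_eq (fun n => (hb n).2) hinj hc0
    rw [← Finsupp.apply_linearCombination, Submodule.mkQ_apply, Submodule.Quotient.mk_eq_zero] at hc
    exact n.2.2 (hdeg n ▸ hn ▸ deg_mem_degrees hc hne)
  have hspan : W ⊔ Submodule.span F (Set.range b) = ⊤ := by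
    refine eq_top_of_degrees_top_subset fun n hn => ?_
    by_cases hnW : n ∈ degrees W
    · obtain ⟨w, ⟨hwW, hw⟩, rfl⟩ := hnW
      exact deg_mem_degrees (Submodule.mem_sup_left hwW) hw
    · exact ⟨b ⟨n, hn, hnW⟩, ⟨Submodule.mem_sup_right (Submodule.subset_span
        (Set.mem_range_self _)), (hb _).2⟩, hdeg ⟨n, hn, hnW⟩⟩
  refine ⟨Module.Basis.mk hli ?_⟩
  rw [Set.range_comp, Submodule.span_image, (Submodule.map_mkQ_eq_top _ _).mpr hspan]

theorem encard_degrees_diff_degrees_span_singleton {a : P.A} (ha : a ≠ 0) :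
    (degrees (⊤ : Submodule F P.A) \ degrees ((Ideal.span {a}).restrictScalars F)).encard =
      (P.deg a).toNat := by
  obtain ⟨d, hd⟩ := Int.eq_ofNat_of_zero_le (deg_nonneg a)
  rw [degrees_span_singleton ha, hd, Int.toNat_natCast]
  rcases Nat.eq_zero_or_pos d with rfl | hd0
  · simp
  refine encard_diff_image_add_eq hd0 ⟨0, ?_⟩ ?_ fun k => ?_
  · rintro _ ⟨b, -, rfl⟩
    exact deg_nonneg b
  · rintro _ ⟨b, ⟨-, hb⟩, rfl⟩
    exact ⟨b * a, ⟨trivial, mul_ne_zero hb ha⟩, (deg_mul hb ha).trans (by rw [hd])⟩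
  · obtain ⟨b, hb, hbk⟩ := exists_deg_modEq (hd ▸ Nat.cast_pos.mpr hd0 : 0 < P.deg a) k
    exact ⟨_, deg_mem_degrees Submodule.mem_top hb, hd ▸ hbk⟩

theorem module_finite_quotient_span_singleton {a : P.A} (ha : a ≠ 0) :
    Module.Finite F (P.A ⧸ Ideal.span {a}) := by
  obtain ⟨b⟩ := nonempty_basis_quotient ((Ideal.span {a}).restrictScalars F)
  have := (Set.finite_of_encard_eq_coe (encard_degrees_diff_degrees_span_singleton ha)).to_subtype
  exact Module.Finite.of_basis (b.map (Submodule.Quotient.restrictScalarsEquiv F _))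

theorem finrank_quotient_span_singleton {a : P.A} (ha : a ≠ 0) :
    Module.finrank F (P.A ⧸ Ideal.span {a}) = (P.deg a).toNat := by
  obtain ⟨b⟩ := nonempty_basis_quotient ((Ideal.span {a}).restrictScalars F)
  rw [Module.finrank_eq_nat_card_basis (b.map (Submodule.Quotient.restrictScalarsEquiv F _)),
    Nat.card_coe_set_eq, Set.ncard, encard_degrees_diff_degrees_span_singleton ha,
    ENat.toNat_natCast]

end Curve

end RationalPoint

end Quotient

/-! ### Generators of the special functions -/

section ProperIdeals

theorem exists_ne_zero_forall_mul_eq_zero {R : Type*} [CommRing R] [IsArtinianRing R] {I : Ideal R}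
    (hI : I ≠ ⊤) : ∃ s ≠ 0, ∀ x ∈ I, x * s = 0 := by
  obtain ⟨m, hm, hIm⟩ := I.exists_le_maximal hI
  have hass : IsAssociatedPrime m R :=
    Module.associatedPrimes.minimalPrimes_annihilator_subset_associatedPrimes R R
      (IsArtinianRing.mem_minimalPrimes ((Module.annihilator_eq_bot.mpr inferInstance).trans_le
        bot_le))
  obtain ⟨-, s, hs⟩ := isAssociatedPrime_iff.mp hass
  have hmem : ∀ x, x ∈ m ↔ x * s = 0 := fun x => by
    rw [hs, Submodule.mem_colon_singleton, Submodule.mem_bot, smul_eq_mul]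
  refine ⟨s, fun h0 => hm.ne_top ((Ideal.eq_top_iff_one m).mpr ((hmem 1).mpr ?_)),
    fun x hx => (hmem x).mp (hIm hx)⟩
  rw [h0, mul_zero]

theorem exists_forall_dvd_mul_not_dvd {R : Type*} [CommRing R] {I : Ideal R} {t : R} (ht : t ∈ I)
    (hI : I ≠ ⊤) [IsArtinianRing (R ⧸ Ideal.span {t})] :
    ∃ s, (∀ x ∈ I, t ∣ x * s) ∧ ¬ t ∣ s := by
  have hI' : I.map (Ideal.Quotient.mk (Ideal.span {t})) ≠ ⊤ := fun h => hI <| by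
    have hle : Ideal.span {t} ≤ I := (Ideal.span_singleton_le_iff_mem I).mpr ht
    rw [← Ideal.comap_map_mk hle, h, Ideal.comap_top]
  obtain ⟨s', hs', h⟩ := exists_ne_zero_forall_mul_eq_zero hI'
  obtain ⟨s, rfl⟩ := Ideal.Quotient.mk_surjective s'
  simp only [ne_eq, Ideal.Quotient.eq_zero_iff_dvd] at hs'
  refine ⟨s, fun x hx => ?_, hs'⟩
  rw [← Ideal.Quotient.eq_zero_iff_dvd, map_mul]
  exact h _ (Ideal.mem_map_of_mem _ hx)

end ProperIdeals

section Smul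

variable {F C A : Type*} [Field F] [CommRing A] [Algebra F A]

theorem exists_comp_mulLeft_eq [IsDomain A] {a : A} (ha : a ≠ 0) (ψ : Module.Dual F A) :
    ∃ χ : Module.Dual F A, χ ∘ₗ LinearMap.mulLeft F a = ψ :=
  LinearMap.dualMap_surjective_of_injective (f := LinearMap.mulLeft F a) (mul_right_injective₀ ha) ψ

variable [Finite F] [NormedField C] [IsUltrametricDist C] [CompleteSpace C] [Algebra F C]

theorem dualEval_smul (a : A) (ω : CompletedTensor F C A) (χ : Module.Dual F A) :
    dualEval (a • ω) χ = dualEval ω (χ ∘ₗ LinearMap.mulLeft F a) := by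
  rw [dualEval_apply, completedContract_smul, dualEval_apply]

variable [IsDomain A]

theorem eq_zero_of_smul_eq_zero {ω : CompletedTensor F C A} (hω : ω ≠ 0) {a : A}
    (h : a • ω = 0) : a = 0 := by
  by_contra ha
  refine hω (completedTensor_ext fun χ => ?_)
  obtain ⟨ψ, rfl⟩ := exists_comp_mulLeft_eq ha χ
  rw [← completedContract_smul, h, completedContract_zero, completedContract_zero]

theorem exists_smul_eq_of_forall_dualEval_eq_zero {ω : CompletedTensor F C A} {t : A} (ht : t ≠ 0)
    (h : ∀ χ : Module.Dual F A, χ ∘ₗ LinearMap.mulLeft F t = 0 → dualEval ω χ = 0) :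
    ∃ η : CompletedTensor F C A, t • η = ω := by
  obtain ⟨π, hπ⟩ := (LinearMap.mulLeft F t).exists_leftInverse_of_injective
    (LinearMap.ker_eq_bot.mpr (mul_right_injective₀ ht))
  refine ⟨completedMapRight π ω, completedTensor_ext fun χ => ?_⟩
  rw [completedContract_smul, completedContract_completedMapRight, ← sub_eq_zero,
    ← dualEval_apply, ← dualEval_apply, ← map_sub]
  refine h _ ?_
  rw [LinearMap.sub_comp, LinearMap.comp_assoc, hπ, LinearMap.comp_id, sub_self]

end Smul

section Generator

namespace DrinfeldModule

variable {F K : Type*} [Field F] [Finite F] [Field K] [Algebra F K] {P : RationalPoint F K} {r : ℕ}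
  {φ : DrinfeldModule P r} {ω : CompletedTensor F P.Cinf P.A}

theorem mem_specialFunctions_iff :
    ω ∈ φ.specialFunctions ↔ ∀ (a : P.A) (χ : Module.Dual F P.A),
      dualEval ω (χ ∘ₗ LinearMap.mulLeft F a) = φ.hom a (dualEval ω χ) := by
  refine forall_congr' fun a => ⟨fun h χ => ?_, fun h => completedTensor_ext fun χ => ?_⟩
  · rw [← dualEval_smul, ← h, dualEval_apply, completedContract_completedMapLeft, dualEval_apply]
  · rw [completedContract_completedMapLeft, completedContract_smul]
    exact (h χ).symm

theorem mem_specialFunctions_of_smul_mem {t : P.A} (ht : t ≠ 0)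
    (h : t • ω ∈ φ.specialFunctions) : ω ∈ φ.specialFunctions := fun a => by
  rw [← sub_eq_zero]
  by_contra hne
  refine ht (eq_zero_of_smul_eq_zero hne ?_)
  rw [smul_sub, ← completedMapLeft_smul, h a, smul_comm, sub_self]

/-- The ideal of the elements of `A` at which every linear form `χ` with `χ(ω) = 0` vanishes;
it is the unit ideal if and only if `χ ↦ χ(ω)` is injective. -/
def kerAnnihilator (hω : ω ∈ φ.specialFunctions) : Ideal P.A where
  carrier := {v | ∀ χ : Module.Dual F P.A, dualEval ω χ = 0 → χ v = 0}
  zero_mem' χ _ := map_zero χ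
  add_mem' hv hw χ hχ := by rw [map_add, hv χ hχ, hw χ hχ, add_zero]
  smul_mem' a v hv χ hχ := hv (χ ∘ₗ LinearMap.mulLeft F a) (by
    rw [mem_specialFunctions_iff.mp hω, hχ, map_zero])

theorem dualEval_eq_zero_of_forall_mem_kerAnnihilator (hω : ω ∈ φ.specialFunctions)
    {χ : Module.Dual F P.A} (hχ : ∀ v ∈ kerAnnihilator hω, χ v = 0) : dualEval ω χ = 0 := by
  refine enorm_eq_zero.mp (nonpos_iff_eq_zero.mp (le_of_forall_gt_imp_ge_of_dense fun r hr => ?_))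
  rw [← mem_dualBall, ← dualCoannihilator_dualAnnihilator_dualBall ω hr,
    Submodule.mem_dualAnnihilator]
  refine fun v hv => hχ v fun ψ hψ => (Submodule.mem_dualCoannihilator v).mp hv ψ ?_
  rw [mem_dualBall, hψ, enorm_zero]
  exact zero_le

-- If the ideal `I = kerAnnihilator hω` were proper, there would be `t ∈ I` and `s` with
-- `t ∣ s I` but `t ∤ s`; then `s • ω` vanishes on the dual of `A / t`, hence `t • η = s • ω` for
-- some special function `η`, which is not a multiple of `ω`.
theorem injective_dualEval_of_generates [IsCurveFunctionField F K] (hω : ω ∈ φ.specialFunctions)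
    (h0 : ω ≠ 0) (hgen : ∀ η ∈ φ.specialFunctions, ∃ a : P.A, η = a • ω) :
    Function.Injective (dualEval ω) := by
  by_cases htop : kerAnnihilator hω = ⊤
  · exact (injective_iff_map_eq_zero _).mpr fun χ hχ => LinearMap.ext fun v =>
      (htop ▸ Submodule.mem_top : v ∈ kerAnnihilator hω) χ hχ
  have hbot : kerAnnihilator hω ≠ ⊥ := fun hbot => h0 <| completedTensor_ext fun χ => by
    rw [completedContract_zero]
    refine dualEval_eq_zero_of_forall_mem_kerAnnihilator hω fun v hv => ?_
    rw [hbot] at hv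
    rw [(Submodule.mem_bot _).mp hv, map_zero]
  obtain ⟨t, htI, ht⟩ := Submodule.exists_mem_ne_zero_of_ne_bot hbot
  have := RationalPoint.module_finite_quotient_span_singleton ht
  have : Finite (P.A ⧸ Ideal.span {t}) := Module.finite_of_finite F
  obtain ⟨s, hdvd, hndvd⟩ := exists_forall_dvd_mul_not_dvd htI htop
  obtain ⟨η, hη⟩ := exists_smul_eq_of_forall_dualEval_eq_zero (ω := s • ω) ht fun χ hχ => by
    rw [dualEval_smul]
    refine dualEval_eq_zero_of_forall_mem_kerAnnihilator hω fun v hv => ?_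
    obtain ⟨u, hu⟩ := hdvd v hv
    rw [LinearMap.comp_apply, LinearMap.mulLeft_apply, mul_comm, hu]
    exact LinearMap.congr_fun hχ u
  obtain ⟨a, rfl⟩ := hgen η <| mem_specialFunctions_of_smul_mem ht <|
    hη ▸ φ.specialFunctions.smul_mem s hω
  refine absurd ⟨a, ?_⟩ hndvd
  rw [← sub_eq_zero]
  refine eq_zero_of_smul_eq_zero h0 ?_
  rw [sub_smul, mul_smul, hη, sub_self]

end DrinfeldModule

end Generator

/-! ### Multiplicativity of the minimal norm in rank one -/

section RankOne

variable {F K : Type*} [Field F] [Finite F] [Field K] [Algebra F K] [IsCurveFunctionField F K]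
  {P : RationalPoint F K}

namespace DrinfeldModule

theorem exists_finset_dualEval_torsion {C : Type*} [NormedField C] [IsUltrametricDist C]
    [CompleteSpace C] [Algebra F C] {ω : CompletedTensor F C P.A}
    (hinj : Function.Injective (dualEval ω)) {a : P.A} (ha : a ≠ 0) :
    ∃ T : Finset C, T.card = Nat.card F ^ (P.deg a).toNat ∧
      ∀ t ∈ T, ∃ κ : Module.Dual F P.A, κ ∘ₗ LinearMap.mulLeft F a = 0 ∧ dualEval ω κ = t := by
  classical
  have := RationalPoint.module_finite_quotient_span_singleton ha
  have : Finite (Module.Dual F (P.A ⧸ Ideal.span {a})) := Module.finite_of_finite F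
  have := Fintype.ofFinite (Module.Dual F (P.A ⧸ Ideal.span {a}))
  let π : P.A →ₗ[F] P.A ⧸ Ideal.span {a} := (Ideal.Quotient.mkₐ F _).toLinearMap
  have hπ : Function.Injective (π.dualMap) :=
    LinearMap.dualMap_injective_of_surjective Ideal.Quotient.mk_surjective
  refine ⟨Finset.univ.image (dualEval ω ∘ π.dualMap), ?_, fun t ht => ?_⟩
  · rw [Finset.card_image_of_injective _ (hinj.comp hπ), Finset.card_univ,
      ← Nat.card_eq_fintype_card, Module.natCard_eq_pow_finrank (K := F),
      Subspace.dual_finrank_eq, RationalPoint.finrank_quotient_span_singleton ha]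
  · obtain ⟨f, -, rfl⟩ := Finset.mem_image.mp ht
    refine ⟨π.dualMap f, LinearMap.ext fun v => ?_, rfl⟩
    have hv : π (a * v) = 0 :=
      (Ideal.Quotient.eq_zero_iff_dvd a (a * v)).mpr (dvd_mul_right a v)
    exact (congrArg f hv).trans (map_zero f)

variable {φ : DrinfeldModule P 1} {ω : CompletedTensor F P.Cinf P.A}

theorem exists_hom_eq_prod (hω : ω ∈ φ.specialFunctions) (hinj : Function.Injective (dualEval ω))
    {a : P.A} (ha : a ≠ 0) :
    ∃ (T : Finset P.Cinf) (l : P.Cinf), l ≠ 0 ∧ (∀ x, φ.hom a x = l * ∏ t ∈ T, (x - t)) ∧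
      ∀ t ∈ T, ∃ κ : Module.Dual F P.A, κ ∘ₗ LinearMap.mulLeft F a = 0 ∧ dualEval ω κ = t := by
  obtain ⟨p, hdeg, hp0, hp⟩ := φ.exists_poly a ha
  obtain ⟨T, hcard, hT⟩ := exists_finset_dualEval_torsion hinj ha
  have hq : 1 < Nat.card F := Finite.one_lt_card
  have hpne : p ≠ 0 := by
    rintro rfl
    rw [Polynomial.coeff_zero] at hp0
    exact ha (Subtype.ext ((map_eq_zero P.toCinf).mp hp0.symm))
  have hhom : ∀ x, φ.hom a x = (qPolynomial (Nat.card F) p).eval x := fun x => by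
    rw [hp, eval_qPolynomial]
  have hlead := leadingCoeff_qPolynomial hq hpne
  have hlne := Polynomial.leadingCoeff_ne_zero.mpr hpne
  refine ⟨T, p.leadingCoeff, hlne, fun x => ?_, hT⟩
  rw [hhom, ← hlead]
  refine eval_eq_leadingCoeff_mul_prod_of_card_eq
    (Polynomial.leadingCoeff_ne_zero.mp (hlead ▸ hlne)) ?_ (fun t ht => ?_) x
  · rw [hcard, natDegree_qPolynomial hq hpne, ← Int.toNat_natCast p.natDegree, hdeg, Nat.cast_one,
      one_mul]
  · obtain ⟨κ, hκ, rfl⟩ := hT t ht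
    rw [Polynomial.IsRoot, ← hhom, ← mem_specialFunctions_iff.mp hω, hκ, map_zero]

-- `χ'` is the translate of `χ` by an `a`-torsion form for which `χ'(ω)` has minimal norm; then
-- `‖χ'(ω) - t‖ = max ‖χ'(ω)‖ ‖t‖` for every root `t` of `φ_a`.
theorem exists_strictMono_enorm (hω : ω ∈ φ.specialFunctions)
    (hinj : Function.Injective (dualEval ω)) {a : P.A} (ha : a ≠ 0) :
    ∃ Φ : ℝ≥0∞ → ℝ≥0∞, StrictMono Φ ∧ ∀ χ : Module.Dual F P.A,
      ∃ χ' : Module.Dual F P.A, χ' ∘ₗ LinearMap.mulLeft F a = χ ∘ₗ LinearMap.mulLeft F a ∧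
        ‖dualEval ω χ'‖ₑ ≤ ‖dualEval ω χ‖ₑ ∧
        ‖dualEval ω (χ ∘ₗ LinearMap.mulLeft F a)‖ₑ = Φ ‖dualEval ω χ'‖ₑ := by
  obtain ⟨T, l, hl, hprod, hT⟩ := exists_hom_eq_prod hω hinj ha
  have hmem : ∀ x, x ∈ T ↔ φ.hom a x = 0 := fun x => by
    simp only [hprod, mul_eq_zero, or_iff_right hl, Finset.prod_eq_zero_iff, sub_eq_zero,
      exists_eq_right']
  have h0 : (0 : P.Cinf) ∈ T := (hmem 0).mpr (map_zero _)
  refine ⟨_, strictMono_mul_prod_max_enorm h0 (enorm_ne_zero.mpr hl) enorm_ne_top, fun χ => ?_⟩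
  obtain ⟨t₀, ht₀, hmin⟩ := T.exists_min_image (fun t => ‖dualEval ω χ - t‖ₑ) ⟨0, h0⟩
  obtain ⟨κ, hκ, hκt⟩ := hT t₀ ht₀
  have hx : dualEval ω (χ - κ) = dualEval ω χ - t₀ := by rw [map_sub, hκt]
  have hcomp : (χ - κ) ∘ₗ LinearMap.mulLeft F a = χ ∘ₗ LinearMap.mulLeft F a := by
    rw [LinearMap.sub_comp, hκ, sub_zero]
  refine ⟨χ - κ, hcomp, by simpa only [hx, sub_zero] using hmin 0 h0, ?_⟩
  rw [← hcomp, mem_specialFunctions_iff.mp hω, hprod, enorm_mul, enorm_prod]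
  congr 1
  refine Finset.prod_congr rfl fun t ht => enorm_sub_eq_max_of_le ?_
  rw [hx, sub_sub]
  refine hmin _ ((hmem _).mpr ?_)
  rw [map_add, (hmem _).mp ht₀, (hmem _).mp ht, add_zero]

theorem exists_strictMono_minNorm (hω : ω ∈ φ.specialFunctions)
    (hinj : Function.Injective (dualEval ω)) {a : P.A} (ha : a ≠ 0) :
    ∃ Φ : ℝ≥0∞ → ℝ≥0∞, StrictMono Φ ∧ ∀ v ≠ 0, minNorm ω v = Φ (minNorm ω (a * v)) := by
  obtain ⟨Φ, hΦ, h⟩ := exists_strictMono_enorm hω hinj ha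
  refine ⟨Φ, hΦ, fun v hv => le_antisymm ?_ ?_⟩
  · obtain ⟨χ, hχ, hN⟩ := exists_enorm_eq_minNorm ω (mul_ne_zero ha hv)
    obtain ⟨χ', -, hle, heq⟩ := h χ
    calc minNorm ω v ≤ ‖dualEval ω (χ ∘ₗ LinearMap.mulLeft F a)‖ₑ := minNorm_le ω hχ
      _ = Φ ‖dualEval ω χ'‖ₑ := heq
      _ ≤ Φ ‖dualEval ω χ‖ₑ := hΦ.monotone hle
      _ = Φ (minNorm ω (a * v)) := congrArg Φ hN
  · obtain ⟨ψ, hψ, hN⟩ := exists_enorm_eq_minNorm ω hv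
    obtain ⟨χ, rfl⟩ := exists_comp_mulLeft_eq ha ψ
    obtain ⟨χ', hχ', -, heq⟩ := h χ
    rw [← hN, heq]
    rw [← hχ'] at hψ
    exact hΦ.monotone (minNorm_le ω hψ)

theorem minNorm_mul_le_mul_iff (hω : ω ∈ φ.specialFunctions)
    (hinj : Function.Injective (dualEval ω)) {a : P.A} (ha : a ≠ 0) (v w : P.A) :
    minNorm ω (a * v) ≤ minNorm ω (a * w) ↔ minNorm ω v ≤ minNorm ω w := by
  rcases eq_or_ne w 0 with rfl | hw
  · simp only [mul_zero, minNorm_zero, le_top]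
  rcases eq_or_ne v 0 with rfl | hv
  · simp only [mul_zero, minNorm_zero, top_le_iff, minNorm_ne_top ω hw,
      minNorm_ne_top ω (mul_ne_zero ha hw)]
  obtain ⟨Φ, hΦ, h⟩ := exists_strictMono_minNorm hω hinj ha
  rw [h v hv, h w hw, hΦ.le_iff_le]

end DrinfeldModule

end RankOne

/-! ### Comparison of the minimal norm with the degree -/

section Monotonicity

theorem exists_dual_apply_eq_one {k V : Type*} [Field k] [AddCommGroup V] [Module k V] {v : V}
    (hv : v ≠ 0) : ∃ χ : Module.Dual k V, χ v = 1 := by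
  obtain ⟨χ, hχ⟩ := Module.Projective.exists_dual_ne_zero k hv
  exact ⟨(χ v)⁻¹ • χ, inv_mul_cancel₀ hχ⟩

variable {F K : Type*} [Field F] [Finite F] [Field K] [Algebra F K] {P : RationalPoint F K}

namespace RationalPoint

theorem isEquiv_val_of_one_lt {Γ₀ : Type*} [LinearOrderedCommGroupWithZero Γ₀]
    {v : Valuation K Γ₀} {b : P.A} (hb : 1 < v (b : K)) : v.IsEquiv P.val := by
  rw [Valuation.isEquiv_iff_valuationSubring]
  by_contra h
  exact hb.not_ge (b.2 v.valuationSubring h)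

theorem deg_le_deg_of_coord_ne_zero {ι : Type*} {b : Module.Basis ι F P.A}
    (hb : Function.Injective fun i => P.deg (b i)) {v : P.A} {j : ι} (hj : b.coord j v ≠ 0) :
    P.deg (b j) ≤ P.deg v := by
  have hc : b.repr v ≠ 0 := fun h => hj (DFunLike.congr_fun h j)
  obtain ⟨i, -, hdeg, hmax⟩ := exists_deg_linearCombination_eq b.ne_zero hb hc
  rw [b.linearCombination_repr] at hdeg
  exact hdeg ▸ hmax j (Finsupp.mem_support_iff.mpr hj)

variable [IsCurveFunctionField F K]

theorem map_lt_map_of_deg_lt {Γ₀ : Type*} [LinearOrderedCommGroupWithZero Γ₀]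
    {v : Valuation P.A Γ₀} (hfin : {x | v x ≤ 1}.Finite) {a b : P.A} (h : P.deg a < P.deg b) :
    v a < v b := by
  have hb : 0 < P.deg b := (deg_nonneg a).trans_lt h
  have hb0 : b ≠ 0 := ne_zero_of_deg_pos hb
  have hlarge : ∀ x ≠ 0, ∃ n : ℕ, 1 < v (x * b ^ n) := by
    intro x hx
    by_contra! hle
    refine Set.infinite_of_injective_forall_mem (f := fun n : ℕ => x * b ^ n) (fun m n hmn => ?_)
      hle hfin
    have hdeg := congrArg P.deg hmn
    simp only [deg_mul hx (pow_ne_zero _ hb0), deg_pow] at hdeg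
    exact_mod_cast mul_right_cancel₀ hb.ne' (add_left_cancel hdeg)
  have hv : ∀ x ≠ 0, v x ≠ 0 := fun x hx hvx => by
    obtain ⟨n, hn⟩ := hlarge x hx
    rw [map_mul, hvx, zero_mul] at hn
    exact not_lt_zero hn
  have hvb : 1 < v b := by
    obtain ⟨n, hn⟩ := hlarge 1 one_ne_zero
    rw [one_mul, map_pow] at hn
    exact lt_of_not_ge fun hle => (pow_le_one₀ zero_le hle).not_gt hn
  rcases eq_or_ne a 0 with rfl | ha
  · rw [map_zero]
    exact zero_lt_one.trans hvb
  have := isFractionRing_A hb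
  have hS : nonZeroDivisors P.A ≤ v.supp.primeCompl := fun x hx =>
    hv x (nonZeroDivisors.ne_zero hx)
  let V : Valuation K Γ₀ := v.extendToLocalization hS K
  have hV : ∀ x : P.A, V (x : K) = v x := v.extendToLocalization_apply_map_apply hS K
  have hequiv : V.IsEquiv P.val := isEquiv_val_of_one_lt (hvb.trans_eq (hV b).symm)
  rw [← hV, ← hV, hequiv.lt_iff_lt, ← deg_lt_deg_iff ha hb0]
  exact h

theorem apply_eq_zero_of_deg_eq_zero {M : Type*} [AddCommGroup M] [Module F M] {f : P.A →ₗ[F] M}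
    (hf : f 1 = 0) {v : P.A} (hv : P.deg v = 0) : f v = 0 := by
  obtain ⟨c, rfl⟩ := exists_eq_algebraMap_of_deg_eq_zero hv
  rw [Algebra.algebraMap_eq_smul_one, map_smul, hf, smul_zero]

theorem forall_deg_eq_zero_or_exists_minimal_deg_pos :
    (∀ v : P.A, P.deg v = 0) ∨ ∃ w : P.A, 0 < P.deg w ∧ ∀ v, P.deg v < P.deg w → P.deg v = 0 := by
  refine or_iff_not_imp_left.mpr fun h => ?_
  obtain ⟨a, ha⟩ := not_forall.mp h
  obtain ⟨w, hw, hmin⟩ := (measure fun v : P.A => (P.deg v).toNat).wf.has_min {v | P.deg v ≠ 0}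
    ⟨a, ha⟩
  refine ⟨w, (deg_nonneg w).lt_of_ne' hw, fun v hv => by_contra fun hne => hmin v hne ?_⟩
  exact (Int.toNat_lt_toNat ((deg_nonneg v).trans_lt hv)).mpr hv

end RationalPoint

namespace DrinfeldModule

variable [IsCurveFunctionField F K] {φ : DrinfeldModule P 1} {ω : CompletedTensor F P.Cinf P.A}

/-- The valuative preorder on `A` in which a function is the larger, the smaller its `minNorm`. -/
abbrev minNormRel (hω : ω ∈ φ.specialFunctions) (hinj : Function.Injective (dualEval ω)) :
    ValuativeRel P.A where
  vle v w := minNorm ω w ≤ minNorm ω v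
  vle_total _ _ := le_total _ _
  vle_trans h h' := h'.trans h
  vle_add h h' := (le_min h h').trans (min_minNorm_le_add ω _ _)
  mul_vle_mul_left {v w} h a := by
    rcases eq_or_ne a 0 with rfl | ha
    · simp only [mul_zero, le_refl]
    · simpa only [mul_comm _ a] using (minNorm_mul_le_mul_iff hω hinj ha w v).mpr h
  vle_mul_cancel {v w a} ha h := by
    refine (minNorm_mul_le_mul_iff hω hinj (a := a) ?_ w v).mp ?_
    · rintro rfl
      exact ha le_rfl
    · simpa only [mul_comm _ a] using h
  vle_mul_comm {v w} := by rw [mul_comm]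
  not_vle_one_zero h := by
    rw [minNorm_zero, top_le_iff] at h
    exact minNorm_ne_top ω one_ne_zero h

theorem minNorm_lt_of_deg_lt (hω : ω ∈ φ.specialFunctions)
    (hinj : Function.Injective (dualEval ω)) {v w : P.A} (h : P.deg v < P.deg w) :
    minNorm ω w < minNorm ω v := by
  let _ := minNormRel hω hinj
  let N := ValuativeRel.valuation P.A
  have hN : ∀ x y : P.A, minNorm ω y ≤ minNorm ω x ↔ N x ≤ N y :=
    Valuation.Compatible.vle_iff_le (v := N)
  have hfin : {x | N x ≤ 1}.Finite :=
    (finite_le_minNorm ω (minNorm_pos hinj 1)).subset fun x hx =>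
      (hN x 1).mpr (hx.trans_eq (map_one N).symm)
  exact not_le.mp fun hle =>
    (RationalPoint.map_lt_map_of_deg_lt hfin h).not_ge ((hN w v).mp hle)

theorem minNorm_le_of_deg_le (hω : ω ∈ φ.specialFunctions)
    (hinj : Function.Injective (dualEval ω)) {v w : P.A} (hv : v ≠ 0) (hw : w ≠ 0)
    (h : P.deg v ≤ P.deg w) : minNorm ω w ≤ minNorm ω v := by
  rcases h.lt_or_eq with hlt | heq
  · exact (minNorm_lt_of_deg_lt hω hinj hlt).le
  have hval := RationalPoint.val_eq_val_of_deg_eq hv hw heq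
  obtain ⟨c, hc⟩ := RationalPoint.exists_val_sub_smul_lt hw hval
  have hc0 : c ≠ 0 := by
    rintro rfl
    rw [zero_smul, sub_zero, hval] at hc
    exact hc.false
  have hsub : minNorm ω w ≤ minNorm ω (v - c • w) := by
    rcases eq_or_ne (v - c • w) 0 with h0 | h0
    · rw [h0, minNorm_zero]
      exact le_top
    · exact (minNorm_lt_of_deg_lt hω hinj ((RationalPoint.deg_lt_deg_iff h0 hw).mpr hc)).le
  calc minNorm ω w ≤ min (minNorm ω (v - c • w)) (minNorm ω (c • w)) :=
        le_min hsub (minNorm_smul ω hc0 w).ge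
    _ ≤ minNorm ω v := by simpa only [sub_add_cancel] using min_minNorm_le_add ω (v - c • w) (c • w)

theorem enorm_dualEval_le_minNorm (hω : ω ∈ φ.specialFunctions)
    (hinj : Function.Injective (dualEval ω)) {w : P.A} (hw : w ≠ 0) {χ : Module.Dual F P.A}
    (hχ : ∀ v, P.deg v < P.deg w → χ v = 0) : ‖dualEval ω χ‖ₑ ≤ minNorm ω w := by
  rw [← mem_dualBall, ← dualCoannihilator_dualAnnihilator_dualBall ω (minNorm_pos hinj w),
    Submodule.mem_dualAnnihilator]
  intro v hv
  rcases eq_or_ne v 0 with rfl | hv0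
  · exact map_zero χ
  refine hχ v (not_le.mp fun hdeg => ?_)
  obtain ⟨ψ, hψ, hN⟩ := exists_enorm_eq_minNorm ω hv0
  exact hψ ((Submodule.mem_dualCoannihilator v).mp hv ψ
    (hN.trans_le (minNorm_le_of_deg_le hω hinj hw hv0 hdeg)))

theorem strictAnti_norm_coord (hω : ω ∈ φ.specialFunctions)
    (hinj : Function.Injective (dualEval ω)) {ι : Type*} [LinearOrder ι] {b : Module.Basis ι F P.A}
    (hb : StrictMono fun i => P.deg (b i)) :
    StrictAnti fun i => ‖completedContract (b.coord i) ω‖ := by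
  intro i j hij
  have hlt : ‖dualEval ω (b.coord j)‖ₑ < ‖dualEval ω (b.coord i)‖ₑ :=
    calc ‖dualEval ω (b.coord j)‖ₑ ≤ minNorm ω (b j) :=
          enorm_dualEval_le_minNorm hω hinj (b.ne_zero j) fun v hdeg => by_contra fun hne =>
            (RationalPoint.deg_le_deg_of_coord_ne_zero hb.injective hne).not_gt hdeg
      _ < minNorm ω (b i) := minNorm_lt_of_deg_lt hω hinj (hb hij)
      _ ≤ ‖dualEval ω (b.coord i)‖ₑ := minNorm_le ω <| by
          rw [b.coord_apply, b.repr_self, Finsupp.single_eq_same]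
          exact one_ne_zero
  exact ENNReal.coe_lt_coe.mp hlt

theorem isUnit_of_injective_dualEval (hω : ω ∈ φ.specialFunctions)
    (hinj : Function.Injective (dualEval ω)) : IsUnit ω := by
  obtain ⟨χ₀, h₀⟩ := exists_dual_apply_eq_one (k := F) (one_ne_zero (α := P.A))
  rcases RationalPoint.forall_deg_eq_zero_or_exists_minimal_deg_pos (P := P) with
    hdeg | ⟨w, hw, hmin⟩
  · have hχ₀ : dualEval ω χ₀ ≠ 0 := (map_ne_zero_iff _ hinj).mpr fun h => by
      rw [h, LinearMap.zero_apply] at h₀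
      exact zero_ne_one h₀
    refine isUnit_of_dominant h₀ (norm_pos_iff.mpr hχ₀) fun χ hχ => ?_
    have hχ' : χ = 0 := LinearMap.ext fun v =>
      RationalPoint.apply_eq_zero_of_deg_eq_zero hχ (hdeg v)
    rw [hχ', map_zero, norm_zero]
  · have hw0 := RationalPoint.ne_zero_of_deg_pos hw
    obtain ⟨ψ, -, hψ⟩ := exists_enorm_eq_minNorm ω hw0
    have hlt : ‖dualEval ω ψ‖ₑ < ‖dualEval ω χ₀‖ₑ :=
      calc ‖dualEval ω ψ‖ₑ = minNorm ω w := hψ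
        _ < minNorm ω 1 := minNorm_lt_of_deg_lt hω hinj <| by
            rwa [← map_one (algebraMap F P.A), RationalPoint.deg_algebraMap]
        _ ≤ ‖dualEval ω χ₀‖ₑ := minNorm_le ω (h₀ ▸ one_ne_zero)
    refine isUnit_of_dominant h₀ (ENNReal.coe_lt_coe.mp hlt) fun χ hχ =>
      enorm_le_iff_norm_le.mp (hψ ▸ enorm_dualEval_le_minNorm hω hinj hw0 fun v hv => ?_)
    exact RationalPoint.apply_eq_zero_of_deg_eq_zero hχ (hmin v hv)

end DrinfeldModule

end Monotonicity

end SpecialFunctions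

end

theorem mainTheorem5 {F K : Type*} [Field F] [Finite F] [Field K] [Algebra F K]
    [SpecialFunctions.IsCurveFunctionField F K] (P : SpecialFunctions.RationalPoint F K)
    (φ : SpecialFunctions.DrinfeldModule P 1)
    (hφ : Nonempty (φ.specialFunctions ≃ₗ[P.A] P.A)) :
    ∃ ω ∈ φ.specialFunctions, IsUnit ω ∧
      ∀ b : Module.Basis ℕ F P.A, StrictMono (fun i => P.deg (b i)) →
        StrictAnti (fun i => ‖SpecialFunctions.completedContract (b.coord i) ω‖) := by
  obtain ⟨e⟩ := hφ
  let ω := e.symm 1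
  have hgen : ∀ η ∈ φ.specialFunctions, ∃ a : P.A, η = a • ω.1 := fun η hη => by
    have h : e ⟨η, hη⟩ • ω = ⟨η, hη⟩ := by
      rw [← map_smul, smul_eq_mul, mul_one, e.symm_apply_apply]
    exact ⟨e ⟨η, hη⟩, (congrArg Subtype.val h).symm⟩
  have hω : ω.1 ≠ 0 := fun h =>
    one_ne_zero (e.symm.map_eq_zero_iff.mp (Subtype.ext h : ω = 0))
  have hinj := SpecialFunctions.DrinfeldModule.injective_dualEval_of_generates ω.2 hω hgen
  exact ⟨ω.1, ω.2, SpecialFunctions.DrinfeldModule.isUnit_of_injective_dualEval ω.2 hinj,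
    fun _ hb => SpecialFunctions.DrinfeldModule.strictAnti_norm_coord ω.2 hinj hb⟩
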